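/- For $t_z\in(0,2)$ and $\mathbf k=(k_1,k_2,k_3)$ let $\varepsilon(\mathbf k)=-2(\cos k_1+\cos k_2)-2t_z\cos k_3$, and let $$N_{t_z}(\epsilon)=\int_{[-\pi,\pi]^3}\delta(\varepsilon(\mathbf k)-\epsilon)\,\frac{d\mathbf k}{(2\pi)^3}=\frac{d}{d\epsilon}\,\frac{\big|\{\mathbf k\in[-\pi,\pi]^3:\varepsilon(\mathbf k)\le\epsilon\}\big|}{(2\pi)^3}$$ be the density of states. By convention $\tanh(\cdot/T)=1$ for $T=0$ and $\tanh(\cdot/y)=1$ for $y=0$. For $U>0$ let $T_N(U,t_z)$ be the unique $T_N>0$ with $$1=\int_{[-\pi,\pi]^3}\frac{U\tanh\big(\frac{\varepsilon(\mathbf k)}{2T_N}\big)}{2\varepsilon(\mathbf k)}\,\frac{d\mathbf k}{(2\pi)^3},$$ and for $0\le T<T_N(U,t_z)$ let $\Delta(U,t_z,T)$ be the unique $\Delta>0$ with $$\Delta=\Delta\int_{[-\pi,\pi]^3}\frac{U\tanh\Big(\frac{\sqrt{\Delta^2+\varepsilon(\mathbf k)^2}}{2T}\Big)}{2\sqrt{\Delta^2+\varepsilon(\mathbf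 k)^2}}\,\frac{d\mathbf k}{(2\pi)^3}.$$ Put $\hat m(U,t_z,T)=\Delta(U,t_z,T)/T_N(U,t_z)$. For $y\in[0,1]$ let $f_{\mathrm{BCS}}(y)$ be the unique $x\ge 0$ with $$\int_0^\infty\Bigg(\frac{\tanh\big(\frac{\sqrt{x^2+\epsilon^2}}{2y}\big)}{\sqrt{x^2+\epsilon^2}}-\frac{\tanh\big(\frac{\epsilon}{2}\big)}{\epsilon}\Bigg)d\epsilon=0 ,$$ the integral being required to converge absolutely. Then these objects are well defined, $N_{t_z}(0)$ exists and is positive for every $t_z\in(0,2)$, and $$\hat m(U,t_z,T)=f_{\mathrm{BCS}}\Big(\frac{T}{T_N(U,t_z)}\Big)+O\Big(U^{-1}e^{-\frac{2}{N_{t_z}(0)U}}\Big)\qquad\text{as }U\downarrow0,$$ uniformly for $t_z$ in compact subsets of $(0,2)$ and for $T\ge0$ such that $T/T_N(U,t_z)$ remains in a compact subset of $[0,1)$. That is, for all compact sets $K_1\subset(0,2)$ and $K_2\subset[0,1)$ there are $C>0$ and $U_0>0$ such that $$\Big|\hat m(U,t_z,T)-f_{\mathrm{BCS}}\Big(\frac{T}{T_N(U,t_z)}\Big)\Big|\le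 C\,U^{-1}e^{-\frac{2}{N_{t_z}(0)U}}$$ for all $U\in(0,U_0)$, all $t_z\in K_1$ and all $T\ge 0$ with $T/T_N(U,t_z)\in K_2$. -/

import Mathlib

open MeasureTheory Set

namespace Hubbard3D

noncomputable section

/-- The cube `[-π, π]³` of momenta `k = (k₁, k₂, k₃)`. -/
def brillouinZone : Set (ℝ × ℝ × ℝ) :=
  Icc (-Real.pi) Real.pi ×ˢ Icc (-Real.pi) Real.pi ×ˢ Icc (-Real.pi) Real.pi

/-- The tight-binding band relation
`ε(k) = -2 (cos k₁ + cos k₂) - 2 t_z cos k₃` (with hopping `t = 1`). -/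
def band (tz : ℝ) (k : ℝ × ℝ × ℝ) : ℝ :=
  -2 * (Real.cos k.1 + Real.cos k.2.1) - 2 * tz * Real.cos k.2.2

/-- The integrated density of states: the integral over `[-π, π]³`, with respect to
`dk / (2π)³`, of the Heaviside function of `e - ε(k)`. -/
def integratedDOS (tz e : ℝ) : ℝ :=
  (volume {k ∈ brillouinZone | band tz k ≤ e}).toReal / (2 * Real.pi) ^ 3

/-- The density of states
`N_{t_z}(e) = ∫_{[-π,π]³} δ(ε(k) - e) dk / (2π)³`, i.e. the derivative with respect to `e`
of the integrated density of states. -/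
def densityOfStates (tz e : ℝ) : ℝ :=
  deriv (integratedDOS tz) e

/-- `tanh (s / (2T))`, with the convention that this is `1` for `T = 0`. -/
def thermalTanh (s T : ℝ) : ℝ :=
  if T = 0 then 1 else Real.tanh (s / (2 * T))

/-- `T > 0` solves the equation for the Néel temperature,
`1 = ∫_{[-π,π]³} U tanh(ε(k) / (2T)) / (2 ε(k)) dk / (2π)³`. -/
def IsNeelTemperature (U tz T : ℝ) : Prop :=
  0 < T ∧
    1 = (∫ k in brillouinZone, U * Real.tanh (band tz k / (2 * T)) / (2 * band tz k))
      / (2 * Real.pi) ^ 3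

/-- The Néel temperature `T_N(U, t_z)`, the solution of the above equation. -/
def neelTemperature (U tz : ℝ) : ℝ :=
  Classical.epsilon (IsNeelTemperature U tz)

/-- `Δ` solves the antiferromagnetic mean-field equation at temperature `T ≥ 0`,
`Δ = Δ ∫_{[-π,π]³} U tanh(√(Δ² + ε(k)²) / (2T)) / (2 √(Δ² + ε(k)²)) dk / (2π)³`. -/
def IsMeanFieldSolution (U tz T Δ : ℝ) : Prop :=
  Δ = Δ * ((∫ k in brillouinZone,
      U * thermalTanh (Real.sqrt (Δ ^ 2 + band tz k ^ 2)) T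
        / (2 * Real.sqrt (Δ ^ 2 + band tz k ^ 2))) / (2 * Real.pi) ^ 3)

open Classical in
/-- The antiferromagnetic order parameter `Δ_AF(U, t_z, T)`: the positive solution of the
mean-field equation if there is one, and `0` otherwise. -/
def orderParameter (U tz T : ℝ) : ℝ :=
  if h : ∃ Δ : ℝ, 0 < Δ ∧ IsMeanFieldSolution U tz T Δ then h.choose else 0

/-- The gap ratio `Δ_AF(U, t_z, T) / T_N(U, t_z)`. -/
def gapRatio (U tz T : ℝ) : ℝ :=
  orderParameter U tz T / neelTemperature U tz

/-- The integrand
`tanh(√(x² + e²) / (2y)) / √(x² + e²) - tanh(e / 2) / e` of the function `J(x, y)`. -/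
def bcsIntegrand (x y e : ℝ) : ℝ :=
  thermalTanh (Real.sqrt (x ^ 2 + e ^ 2)) y / Real.sqrt (x ^ 2 + e ^ 2) - Real.tanh (e / 2) / e

/-- `x ≥ 0` solves `J(x, y) = 0`, where `J(x, y)` is the integral of `bcsIntegrand x y` over
`(0, ∞)`. The integral is required to converge absolutely, which it does unless
`x = y = 0`; the true value of `J(0, 0)` is `+∞`. -/
def IsBCSGap (x y : ℝ) : Prop :=
  0 ≤ x ∧ IntegrableOn (bcsIntegrand x y) (Ioi 0) ∧ ∫ e in Ioi 0, bcsIntegrand x y e = 0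

/-- The BCS function: `f_BCS(y)` is the solution `x ≥ 0` of `J(x, y) = 0`. -/
def fBCS (y : ℝ) : ℝ :=
  Classical.epsilon fun x : ℝ => IsBCSGap x y

end

end Hubbard3D

/-!
Write `ε` for the band and `N` for the density of states at the Fermi level `0`. All equations
involve integrals `∫ φ(ε(k)) dk` over the Brillouin zone, with `φ` an even function that is
concentrated on the scale of the Néel temperature `τ`. The heart of the matter is that such an
integral equals `(2π)³ N ∫ φ` up to second moments of `φ`
(`exists_abs_integral_comp_band_sub_le`). This expresses that the density of states is even and
smooth near the Fermi level, and it holds since `0` is not a critical value of `ε` for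
`0 < t_z < 2`. It is proved without constructing the density of states: there is a vector field `V`
with trigonometric polynomials as components for which `V · ∇ε = c + O(ε²)`, `c > 0`
(`sum_transversalField_mul_fderiv_band`), and integrating by parts twice along `V`
(`integral_comp_band_mul`) replaces `φ` by its second antiderivative, which is `m |e| + const`,
`m = ∫₀⁸ φ`, up to tails; here `8` bounds all energies. Testing with cut-offs shows that the
constant `N` found in this way is the derivative of the integrated density of states at `0`
(`hasDerivAt_integratedDOS`).

With `Δ = τ x` and `T = τ y`, the difference of the mean-field equation and the equation for the
Néel temperature has the rescaled BCS integrand as `φ`. It decays like `τ² / e³`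
(`abs_bcsKernel_le`), so its second moments are of the order `τ² ∫ dk / (τ + |ε(k)|)`, and the last
integral is at most a constant times `1 / U` by the equation for the Néel temperature itself. Hence
the difference of the two equations is `2 N J(x, y) + O(τ² / U)`
(`exists_abs_meanFieldIntegral_sub_le`), where `J(x, y) = 0` is the BCS gap equation.
Both sides decrease in `x`, and `J` does so at a positive rate as long as `x` stays away from `0`
(`exists_bcsIntegral_sub_ge`), which traps the gap ratio in an interval of length `O(τ² / U)` around
the BCS gap (`exists_abs_gapRatio_sub_le`). Finally `τ = O(exp (-1 / (N U)))`
(`exists_neelTemperature_le_exp`), again by comparing the integral in the equation for the Néel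
temperature with `N log (1 / τ)`.
-/

namespace Hubbard3D

/-! ### The functions `tanh u / u` and `tanh (ρ / 2T) / ρ` -/

theorem hasDerivAt_tanh (u : ℝ) : HasDerivAt Real.tanh (1 / Real.cosh u ^ 2) u := by
  have h := (Real.hasDerivAt_sinh u).div (Real.hasDerivAt_cosh u) (Real.cosh_pos u).ne'
  have h2 : (Real.sinh / Real.cosh : ℝ → ℝ) = Real.tanh := by
    funext x; simp [Real.tanh_eq_sinh_div_cosh]
  rw [h2] at h
  refine h.congr_deriv ?_
  have := Real.cosh_sq u
  congr 1
  nlinarith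

theorem tanh_le_one (u : ℝ) : Real.tanh u ≤ 1 := by
  rw [Real.tanh_eq_sinh_div_cosh, div_le_one (Real.cosh_pos u)]
  exact (Real.sinh_lt_cosh u).le

theorem strictMono_tanh : StrictMono Real.tanh := by
  apply strictMono_of_deriv_pos
  intro x
  rw [(hasDerivAt_tanh x).deriv]
  have := Real.cosh_pos x
  positivity

theorem tanh_pos {u : ℝ} (hu : 0 < u) : 0 < Real.tanh u := by
  simpa using strictMono_tanh hu

theorem one_sub_tanh_le (u : ℝ) : 1 - Real.tanh u ≤ 2 * Real.exp (-(2 * u)) := by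
  have hc := Real.cosh_pos u
  rw [Real.tanh_eq_sinh_div_cosh, one_sub_div hc.ne', Real.cosh_sub_sinh, div_le_iff₀ hc,
    Real.cosh_eq]
  have h1 : Real.exp (-(2 * u)) * Real.exp u = Real.exp (-u) := by
    rw [← Real.exp_add]; ring_nf
  have h2 : 0 < Real.exp (-(2 * u)) * Real.exp (-u) := by positivity
  nlinarith

/-- The numerator of `-(tanh u / u)' = (tanh u - u / cosh² u) / u²`. -/
noncomputable def tanhDefect (u : ℝ) : ℝ := Real.tanh u - u / Real.cosh u ^ 2

theorem tanhDefect_monotoneOn : MonotoneOn tanhDefect (Ici 0) := by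
  have hd : ∀ u : ℝ, HasDerivAt tanhDefect (2 * u * Real.sinh u / Real.cosh u ^ 3) u := by
    intro u
    have hc := (Real.cosh_pos u).ne'
    have h := (hasDerivAt_tanh u).sub
      ((hasDerivAt_id u).div ((Real.hasDerivAt_cosh u).pow 2) (pow_ne_zero 2 hc))
    refine h.congr_deriv ?_
    simp
    field_simp
    ring
  refine monotoneOn_of_deriv_nonneg (convex_Ici 0)
    (fun u _ => (hd u).continuousAt.continuousWithinAt)
    (fun u _ => (hd u).differentiableAt.differentiableWithinAt) ?_
  intro u hu
  rw [interior_Ici] at hu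
  rw [(hd u).deriv]
  have h1 := Real.cosh_pos u
  have h2 := Real.sinh_pos_iff.2 hu
  have h3 : 0 < u := hu
  positivity

theorem tanhDefect_le_one {u : ℝ} (hu : 0 ≤ u) : tanhDefect u ≤ 1 := by
  have := tanh_le_one u
  have h : 0 ≤ u / Real.cosh u ^ 2 := by positivity
  unfold tanhDefect
  linarith

theorem one_add_sq_div_two_le_cosh (u : ℝ) : 1 + u ^ 2 / 2 ≤ Real.cosh u := by
  have h := Real.cosh_two_mul (u / 2)
  have h1 := Real.cosh_sq (u / 2)
  have h2 : (u / 2) ^ 2 ≤ Real.sinh (u / 2) ^ 2 := by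
    rcases le_total 0 u with h | h
    · exact pow_le_pow_left₀ (by linarith) (Real.self_le_sinh_iff.2 (by linarith)) 2
    · have := pow_le_pow_left₀ (a := -(u / 2)) (by linarith)
        (Real.self_le_sinh_iff.2 (by linarith)) 2
      rw [Real.sinh_neg] at this
      nlinarith
  rw [show 2 * (u / 2) = u by ring] at h
  nlinarith

theorem le_tanhDefect {u : ℝ} (hu : 0 ≤ u) : u ^ 3 / (2 * Real.cosh u ^ 2) ≤ tanhDefect u := by
  have hc := Real.cosh_pos u
  have h : tanhDefect u = (2 * (Real.sinh u * Real.cosh u - u)) / (2 * Real.cosh u ^ 2) := by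
    unfold tanhDefect
    rw [Real.tanh_eq_sinh_div_cosh]
    field_simp
  rw [h]
  gcongr
  have h1 := Real.self_le_sinh_iff.2 hu
  have h2 := one_add_sq_div_two_le_cosh u
  have h3 : u * (1 + u ^ 2 / 2) ≤ Real.sinh u * Real.cosh u := by gcongr
  nlinarith

theorem tanhDefect_pos {u : ℝ} (hu : 0 < u) : 0 < tanhDefect u :=
  lt_of_lt_of_le (by have := Real.cosh_pos u; positivity) (le_tanhDefect hu.le)

/-- The function `tanh u / u`, with the value `1` at `u = 0`. -/
noncomputable def tanhc (u : ℝ) : ℝ := dslope Real.tanh 0 u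

theorem tanhc_of_ne {u : ℝ} (hu : u ≠ 0) : tanhc u = Real.tanh u / u := by
  simp [tanhc, dslope_of_ne _ hu, slope_def_field]

@[simp] theorem tanhc_zero : tanhc 0 = 1 := by
  simp [tanhc, (hasDerivAt_tanh 0).deriv]

theorem continuous_tanhc : Continuous tanhc := by
  rw [← continuousOn_univ]
  refine (continuousOn_dslope Filter.univ_mem).2 ⟨?_, (hasDerivAt_tanh 0).differentiableAt⟩
  exact fun u _ => (hasDerivAt_tanh u).continuousAt.continuousWithinAt

theorem tanhc_neg (u : ℝ) : tanhc (-u) = tanhc u := by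
  by_cases hu : u = 0
  · simp [hu]
  · rw [tanhc_of_ne hu, tanhc_of_ne (neg_ne_zero.2 hu), Real.tanh_neg, neg_div_neg_eq]

theorem tanhc_abs (u : ℝ) : tanhc |u| = tanhc u := by
  rcases abs_choice u with h | h <;> rw [h]
  exact tanhc_neg u

theorem hasDerivAt_tanhc {u : ℝ} (hu : u ≠ 0) : HasDerivAt tanhc (-tanhDefect u / u ^ 2) u := by
  have h := (hasDerivAt_tanh u).div (hasDerivAt_id u) hu
  refine (h.congr_of_eventuallyEq ?_).congr_deriv ?_
  · filter_upwards [isOpen_ne.mem_nhds hu] with v hv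
    exact tanhc_of_ne hv
  · have := (Real.cosh_pos u).ne'
    simp only [id, tanhDefect]
    field_simp
    ring

theorem tanhc_strictAntiOn : StrictAntiOn tanhc (Ici 0) := by
  refine strictAntiOn_of_deriv_neg (convex_Ici 0) continuous_tanhc.continuousOn ?_
  intro u hu
  rw [interior_Ici] at hu
  have hu' : 0 < u := hu
  rw [(hasDerivAt_tanhc hu'.ne').deriv, neg_div]
  have := tanhDefect_pos hu'
  have : 0 < tanhDefect u / u ^ 2 := by positivity
  linarith

theorem tanhc_pos (u : ℝ) : 0 < tanhc u := by
  rw [← tanhc_abs]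
  rcases (abs_nonneg u).eq_or_lt with h | h
  · simp [← h]
  · rw [tanhc_of_ne h.ne']
    exact div_pos (tanh_pos h) h

theorem tanhc_le_one (u : ℝ) : tanhc u ≤ 1 := by
  rw [← tanhc_abs, ← tanhc_zero]
  exact tanhc_strictAntiOn.antitoneOn self_mem_Ici (abs_nonneg u) (abs_nonneg u)

theorem inv_one_add_le_tanhc {u : ℝ} (hu : 0 ≤ u) : 1 / (1 + u) ≤ tanhc u := by
  rcases hu.eq_or_lt with h | h
  · simp [← h]
  rw [tanhc_of_ne h.ne', div_le_div_iff₀ (by positivity) h, one_mul,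
    Real.tanh_eq_sinh_div_cosh, div_mul_eq_mul_div, le_div_iff₀ (Real.cosh_pos u)]
  -- `u cosh u ≤ (1 + u) sinh u` because `u (cosh u - sinh u) = u e⁻ᵘ` and `u ≤ sinh u`
  have h1 := Real.self_le_sinh_iff.2 hu
  have h2 := Real.cosh_sub_sinh u
  have h3 : Real.exp (-u) ≤ 1 := Real.exp_le_one_iff.2 (by linarith)
  nlinarith

/-- The kernel `ρ ↦ tanh (ρ / (2T)) / ρ` of the gap equation, extended continuously to `ρ = 0`
for `T > 0`, and `1 / ρ` for `T = 0`. -/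
noncomputable def gapKernel (T ρ : ℝ) : ℝ :=
  if T = 0 then 1 / ρ else tanhc (ρ / (2 * T)) / (2 * T)

theorem gapKernel_zero (ρ : ℝ) : gapKernel 0 ρ = 1 / ρ := by simp [gapKernel]

theorem gapKernel_of_pos {T : ℝ} (hT : 0 < T) (ρ : ℝ) :
    gapKernel T ρ = tanhc (ρ / (2 * T)) / (2 * T) := by simp [gapKernel, hT.ne']

theorem thermalTanh_div {T ρ : ℝ} (hρ : ρ ≠ 0) : thermalTanh ρ T / ρ = gapKernel T ρ := by
  unfold thermalTanh gapKernel
  split_ifs with h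
  · rfl
  · rw [tanhc_of_ne (by positivity)]
    field_simp

theorem tanh_div {T ρ : ℝ} (hT : 0 < T) (hρ : ρ ≠ 0) :
    Real.tanh (ρ / (2 * T)) / ρ = gapKernel T ρ := by
  rw [← thermalTanh_div hρ, thermalTanh, if_neg hT.ne']

theorem gapKernel_pos {T ρ : ℝ} (hT : 0 ≤ T) (hρ : 0 < ρ) : 0 < gapKernel T ρ := by
  rcases hT.eq_or_lt with rfl | h
  · rw [gapKernel_zero]; positivity
  · rw [gapKernel_of_pos h]
    have := tanhc_pos (ρ / (2 * T))
    positivity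

theorem gapKernel_pos_of_pos {T : ℝ} (hT : 0 < T) (ρ : ℝ) : 0 < gapKernel T ρ := by
  rw [gapKernel_of_pos hT]
  have := tanhc_pos (ρ / (2 * T))
  positivity

theorem gapKernel_le_inv {T ρ : ℝ} (hρ : 0 < ρ) : gapKernel T ρ ≤ 1 / ρ := by
  rw [← thermalTanh_div hρ.ne']
  gcongr
  unfold thermalTanh
  split_ifs
  · exact le_rfl
  · exact tanh_le_one _

theorem gapKernel_le {T : ℝ} (hT : 0 < T) (ρ : ℝ) : gapKernel T ρ ≤ 1 / (2 * T) := by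
  rw [gapKernel_of_pos hT]
  gcongr
  exact tanhc_le_one _

theorem gapKernel_abs {T : ℝ} (hT : 0 < T) (ρ : ℝ) : gapKernel T |ρ| = gapKernel T ρ := by
  rw [gapKernel_of_pos hT, gapKernel_of_pos hT, ← tanhc_abs (ρ / (2 * T)), abs_div,
    abs_of_pos (by positivity : 0 < 2 * T)]

theorem inv_le_gapKernel {T ρ : ℝ} (hT : 0 < T) (hρ : 0 ≤ ρ) :
    1 / (2 * T + ρ) ≤ gapKernel T ρ := by
  rw [gapKernel_of_pos hT]
  have h := inv_one_add_le_tanhc (u := ρ / (2 * T)) (by positivity)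
  calc 1 / (2 * T + ρ) = 1 / (1 + ρ / (2 * T)) / (2 * T) := by field_simp
    _ ≤ _ := by gcongr

theorem gapKernel_antitone_left {T T' ρ : ℝ} (hT : 0 ≤ T) (h : T ≤ T') (hρ : 0 < ρ) :
    gapKernel T' ρ ≤ gapKernel T ρ := by
  rcases hT.eq_or_lt with rfl | hT
  · rw [gapKernel_zero]; exact gapKernel_le_inv hρ
  rw [← tanh_div hT hρ.ne', ← tanh_div (hT.trans_le h) hρ.ne']
  gcongr
  exact strictMono_tanh.monotone (by gcongr)

theorem gapKernel_strictAnti_left {T T' ρ : ℝ} (hT : 0 < T) (h : T < T') (hρ : 0 < ρ) :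
    gapKernel T' ρ < gapKernel T ρ := by
  rw [← tanh_div hT hρ.ne', ← tanh_div (hT.trans h) hρ.ne']
  gcongr
  exact strictMono_tanh (by gcongr)

theorem gapKernel_strictAntiOn {T : ℝ} (hT : 0 ≤ T) : StrictAntiOn (gapKernel T) (Ioi 0) := by
  intro ρ hρ ρ' hρ' h
  have h0 : 0 < ρ := hρ
  rcases hT.eq_or_lt with rfl | hT
  · rw [gapKernel_zero, gapKernel_zero]
    gcongr
  · rw [gapKernel_of_pos hT, gapKernel_of_pos hT]
    gcongr
    refine tanhc_strictAntiOn ?_ ?_ (by gcongr)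
    · exact (by positivity : 0 ≤ ρ / (2 * T))
    · exact (by have := h0.trans h; positivity : 0 ≤ ρ' / (2 * T))

theorem gapKernel_mul {a : ℝ} (ha : 0 < a) (T ρ : ℝ) :
    gapKernel (a * T) (a * ρ) = gapKernel T ρ / a := by
  unfold gapKernel
  by_cases hT : T = 0
  · simp [hT, div_eq_mul_inv, mul_comm]
  · rw [if_neg (mul_ne_zero ha.ne' hT), if_neg hT]
    have : a * ρ / (2 * (a * T)) = ρ / (2 * T) := by field_simp
    rw [this]
    field_simp

theorem continuous_gapKernel {T : ℝ} (hT : 0 < T) : Continuous (gapKernel T) := by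
  have : gapKernel T = fun ρ => tanhc (ρ / (2 * T)) / (2 * T) := funext (gapKernel_of_pos hT)
  rw [this]
  exact (continuous_tanhc.comp (continuous_id.div_const _)).div_const _

theorem continuousOn_gapKernel {T : ℝ} (hT : 0 ≤ T) : ContinuousOn (gapKernel T) (Ioi 0) := by
  rcases hT.eq_or_lt with rfl | hT
  · have : gapKernel 0 = fun ρ => 1 / ρ := funext gapKernel_zero
    rw [this]
    exact continuousOn_const.div continuousOn_id fun x hx => (ne_of_gt hx)
  · exact (continuous_gapKernel hT).continuousOn

theorem measurable_gapKernel (T : ℝ) : Measurable (gapKernel T) := by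
  unfold gapKernel
  split_ifs
  · exact measurable_const.div measurable_id
  · exact (continuous_tanhc.measurable.comp (measurable_id.div_const _)).div_const _

/-- At large `ρ` the kernels at temperatures `T ≤ 1` are exponentially close to `1 / ρ`. -/
theorem abs_gapKernel_sub_inv_le {T ρ : ℝ} (hT : 0 ≤ T) (hT1 : T ≤ 1) (hρ : 0 < ρ) :
    |gapKernel T ρ - 1 / ρ| ≤ 2 * Real.exp (-ρ) / ρ := by
  rw [abs_sub_comm, abs_of_nonneg (sub_nonneg.2 (gapKernel_le_inv hρ))]
  have h1 := gapKernel_antitone_left hT hT1 hρ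
  have h2 := one_sub_tanh_le (ρ / (2 * 1))
  rw [← tanh_div one_pos hρ.ne'] at h1
  have h3 : (2 : ℝ) * (ρ / (2 * 1)) = ρ := by ring
  rw [h3] at h2
  calc 1 / ρ - gapKernel T ρ ≤ 1 / ρ - Real.tanh (ρ / (2 * 1)) / ρ := by linarith
    _ = (1 - Real.tanh (ρ / (2 * 1))) / ρ := by ring
    _ ≤ _ := by gcongr

theorem hasDerivAt_gapKernel {T ρ : ℝ} (hT : 0 < T) (hρ : 0 < ρ) :
    HasDerivAt (gapKernel T) (-tanhDefect (ρ / (2 * T)) / ρ ^ 2) ρ := by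
  have h1 : HasDerivAt (fun r : ℝ => r / (2 * T)) (1 / (2 * T)) ρ := (hasDerivAt_id ρ).div_const _
  have h := ((hasDerivAt_tanhc (u := ρ / (2 * T)) (by positivity)).comp ρ h1).div_const (2 * T)
  have : gapKernel T = fun ρ => tanhc (ρ / (2 * T)) / (2 * T) := funext (gapKernel_of_pos hT)
  rw [this]
  refine h.congr_deriv ?_
  field_simp

/-- A quantitative form of the monotonicity of the gap kernel, uniform in the temperature
`T ∈ [0, 1]`: the kernel decreases in `ρ²` at least at a positive rate. It holds since the
derivative in `ρ` is largest at `T = 1`. -/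
theorem exists_gapKernel_sub_ge (R : ℝ) : ∃ c : ℝ, 0 < c ∧ ∀ T ∈ Icc (0 : ℝ) 1,
    ∀ ρ ρ' : ℝ, 0 < ρ → ρ ≤ ρ' → ρ' ≤ R →
      c * (ρ' ^ 2 - ρ ^ 2) ≤ gapKernel T ρ - gapKernel T ρ' := by
  have hc := Real.cosh_pos (R / 2)
  refine ⟨1 / (32 * Real.cosh (R / 2) ^ 2), by positivity, ?_⟩
  set c := 1 / (32 * Real.cosh (R / 2) ^ 2) with hcdef
  intro T hT ρ ρ' hρ hρρ' hR
  -- `2 c r ≤ tanhDefect (r / 2) / r²` on `(0, R]`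
  have key : ∀ r ∈ Ioc (0 : ℝ) R, 2 * c * r ^ 3 ≤ tanhDefect (r / 2) := by
    intro r hr
    refine le_trans ?_ (le_tanhDefect (by linarith [hr.1]))
    have h1 : Real.cosh (r / 2) ≤ Real.cosh (R / 2) := by
      rw [Real.cosh_le_cosh, abs_of_pos (by linarith [hr.1]), abs_of_pos (by linarith [hr.1, hr.2])]
      linarith [hr.2]
    have hr0 := hr.1
    have h2 := Real.cosh_pos (r / 2)
    calc 2 * c * r ^ 3 = (r / 2) ^ 3 / (2 * Real.cosh (R / 2) ^ 2) := by
          rw [hcdef]; field_simp; ring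
      _ ≤ _ := by gcongr
  have hderiv : ∀ r ∈ Ioc (0 : ℝ) R, ∃ K, tanhDefect (r / 2) ≤ K ∧
      HasDerivAt (gapKernel T) (-K / r ^ 2) r := by
    intro r hr
    have hr0 := hr.1
    rcases hT.1.eq_or_lt with h | h
    · refine ⟨1, tanhDefect_le_one (by linarith), ?_⟩
      have h2 : gapKernel T = fun ρ => ρ⁻¹ := by
        funext s; rw [← h, gapKernel_zero, one_div]
      rw [h2]
      exact (hasDerivAt_inv hr0.ne').congr_deriv (by field_simp)
    · refine ⟨_, tanhDefect_monotoneOn ?_ ?_ ?_, hasDerivAt_gapKernel h hr0⟩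
      · exact (by positivity : 0 ≤ r / 2)
      · exact (by positivity : 0 ≤ r / (2 * T))
      · have := hT.2
        gcongr
        linarith
  have hanti : AntitoneOn (fun r => gapKernel T r + c * r ^ 2) (Ioc 0 R) := by
    have hD : ∀ r ∈ Ioc (0 : ℝ) R, ∃ D ≤ 0,
        HasDerivAt (fun r => gapKernel T r + c * r ^ 2) D r := by
      intro r hr
      obtain ⟨K, hK, hd⟩ := hderiv r hr
      have hr0 := hr.1
      refine ⟨_, ?_, hd.add (((hasDerivAt_id r).pow 2).const_mul c)⟩
      have h1 := (key r hr).trans hK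
      have h2 : 2 * c * r ≤ K / r ^ 2 := by
        rw [le_div_iff₀ (by positivity)]
        nlinarith
      have h3 : -K / r ^ 2 = -(K / r ^ 2) := by ring
      simp only [id, Nat.cast_ofNat, mul_one, h3]
      norm_num
      linarith
    refine antitoneOn_of_deriv_nonpos (convex_Ioc 0 R) ?_ ?_ ?_
    · intro r hr
      obtain ⟨D, _, hd⟩ := hD r hr
      exact hd.continuousAt.continuousWithinAt
    · intro r hr
      obtain ⟨D, _, hd⟩ := hD r (interior_subset hr)
      exact hd.differentiableAt.differentiableWithinAt
    · intro r hr
      obtain ⟨D, h0, hd⟩ := hD r (interior_subset hr)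
      rw [hd.deriv]; exact h0
  have := hanti ⟨hρ, hρρ'.trans hR⟩ ⟨hρ.trans_le hρρ', hR⟩ hρρ'
  simp only at this
  linarith

/-- The pointwise inequality behind `Δ ≤ 2 T_N`: it says `e / sinh (e / 2) ≤ 2`. -/
theorem gapKernel_sqrt_le {a e : ℝ} (ha : 0 < a) (he : 0 < e) (T : ℝ) :
    gapKernel T (Real.sqrt ((2 * a) ^ 2 + e ^ 2)) ≤ gapKernel a e := by
  have hs : 0 < (2 * a) ^ 2 + e ^ 2 := by positivity
  refine (gapKernel_le_inv (Real.sqrt_pos.2 hs)).trans ?_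
  rw [← tanh_div ha he.ne', div_le_div_iff₀ (Real.sqrt_pos.2 hs) he, one_mul]
  have hu : 0 < e / (2 * a) := by positivity
  have hee : e = 2 * a * (e / (2 * a)) := by field_simp
  set u := e / (2 * a)
  have h1 := Real.self_le_sinh_iff.2 hu.le
  have hc := Real.cosh_pos u
  have hsq := Real.cosh_sq u
  refine le_of_sq_le_sq ?_ (by have := tanh_pos hu; positivity)
  rw [mul_pow, Real.sq_sqrt hs.le, Real.tanh_eq_sinh_div_cosh, div_pow, div_mul_eq_mul_div,
    le_div_iff₀ (by positivity), hee, hsq]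
  nlinarith [mul_pos ha ha, pow_le_pow_left₀ hu.le h1 2, mul_le_mul_of_nonneg_left
    (pow_le_pow_left₀ hu.le h1 2) (by positivity : 0 ≤ 4 * a ^ 2)]

/-! ### Integration by parts on the Brillouin zone -/

theorem isCompact_brillouinZone : IsCompact brillouinZone :=
  isCompact_Icc.prod (isCompact_Icc.prod isCompact_Icc)

theorem measurableSet_brillouinZone : MeasurableSet brillouinZone :=
  isCompact_brillouinZone.measurableSet

theorem integrableOn_brillouinZone {f : ℝ × ℝ × ℝ → ℝ} (hf : Continuous f) :
    IntegrableOn f brillouinZone :=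
  hf.continuousOn.integrableOn_compact isCompact_brillouinZone

/-- The standard basis of momentum space. -/
def basisVec : Fin 3 → ℝ × ℝ × ℝ := ![(1, 0, 0), (0, 1, 0), (0, 0, 1)]

/-- Functions of the momentum that have period `2π` in each component. -/
def IsPeriodic (f : ℝ × ℝ × ℝ → ℝ) : Prop :=
  ∀ i k, f (k + (2 * Real.pi) • basisVec i) = f k

theorem IsPeriodic.mul {f g : ℝ × ℝ × ℝ → ℝ} (hf : IsPeriodic f) (hg : IsPeriodic g) :
    IsPeriodic fun k => f k * g k := fun i k => by simp only [hf i k, hg i k]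

theorem IsPeriodic.comp {f : ℝ × ℝ × ℝ → ℝ} (hf : IsPeriodic f) (Φ : ℝ → ℝ) :
    IsPeriodic fun k => Φ (f k) := fun i k => by simp only [hf i k]

theorem IsPeriodic.fderiv {f : ℝ × ℝ × ℝ → ℝ} (hf : IsPeriodic f) (v : ℝ × ℝ × ℝ) :
    IsPeriodic fun k => fderiv ℝ f k v := by
  intro i k
  simp only
  rw [← fderiv_comp_add_right, funext (hf i)]

theorem setIntegral_deriv_eq_zero {g g' : ℝ → ℝ} (hg : ∀ x, HasDerivAt g (g' x) x)
    (hg' : Continuous g') (h : g Real.pi = g (-Real.pi)) :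
    ∫ x in Icc (-Real.pi) Real.pi, g' x = 0 := by
  rw [integral_Icc_eq_integral_Ioc, ← intervalIntegral.integral_of_le (by linarith [Real.pi_pos]),
    intervalIntegral.integral_eq_sub_of_hasDerivAt (fun x _ => hg x) (hg'.intervalIntegrable _ _),
    h, sub_self]

theorem setIntegral_prod_symm {α β : Type*} [MeasurableSpace α] [MeasurableSpace β]
    {μ : Measure α} {ν : Measure β} [SFinite μ] [SFinite ν] (f : α × β → ℝ) {s : Set α} {t : Set β}
    (hf : IntegrableOn f (s ×ˢ t) (μ.prod ν)) :
    ∫ z in s ×ˢ t, f z ∂μ.prod ν = ∫ y in t, ∫ x in s, f (x, y) ∂μ ∂ν := by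
  simp only [← Measure.prod_restrict s t, IntegrableOn] at hf ⊢
  exact integral_prod_symm f hf

/-- The divergence theorem on the torus, for one component at a time. -/
theorem integral_fderiv_eq_zero {F : ℝ × ℝ × ℝ → ℝ} (hF : ContDiff ℝ 1 F) (hp : IsPeriodic F)
    (i : Fin 3) : ∫ k in brillouinZone, fderiv ℝ F k (basisVec i) = 0 := by
  have hc : Continuous fun k => fderiv ℝ F k (basisVec i) :=
    (hF.continuous_fderiv one_ne_zero).clm_apply continuous_const
  have hd : ∀ k, HasFDerivAt F (fderiv ℝ F k) k := fun k =>
    (hF.differentiable one_ne_zero k).hasFDerivAt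
  have hI := integrableOn_brillouinZone hc
  have hcpt : IsCompact (Icc (-Real.pi) Real.pi) := isCompact_Icc
  rw [Measure.volume_eq_prod] at hI ⊢
  have hpi : (-Real.pi + 2 * Real.pi) = Real.pi := by ring
  fin_cases i
  · rw [brillouinZone, setIntegral_prod_symm _ hI]
    refine integral_eq_zero_of_ae (Filter.Eventually.of_forall fun y => ?_)
    refine setIntegral_deriv_eq_zero (g := fun x => F (x, y)) ?_
      (hc.comp (by fun_prop : Continuous fun x : ℝ => (x, y))) ?_
    · intro x
      exact (hd (x, y)).comp_hasDerivAt x ((hasDerivAt_id x).prodMk (hasDerivAt_const x y))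
    · have := hp 0 (-Real.pi, y)
      have h0 : ((0 : ℝ), (0 : ℝ)) = 0 := rfl
      simpa [basisVec, hpi, h0] using this
  · rw [brillouinZone, setIntegral_prod _ hI]
    refine integral_eq_zero_of_ae (Filter.Eventually.of_forall fun x => ?_)
    simp only
    rw [Measure.volume_eq_prod, setIntegral_prod_symm]
    · refine integral_eq_zero_of_ae (Filter.Eventually.of_forall fun z => ?_)
      refine setIntegral_deriv_eq_zero (g := fun y => F (x, y, z)) ?_
        (hc.comp (by fun_prop : Continuous fun y : ℝ => (x, y, z))) ?_
      · intro y
        exact (hd (x, y, z)).comp_hasDerivAt y ((hasDerivAt_const y x).prodMk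
          ((hasDerivAt_id y).prodMk (hasDerivAt_const y z)))
      · have := hp 1 (x, -Real.pi, z)
        simpa [basisVec, hpi] using this
    · exact (hc.comp (by fun_prop : Continuous fun y : ℝ × ℝ => (x, y))).continuousOn
        |>.integrableOn_compact (hcpt.prod hcpt)
  · rw [brillouinZone, setIntegral_prod _ hI]
    refine integral_eq_zero_of_ae (Filter.Eventually.of_forall fun x => ?_)
    simp only
    rw [Measure.volume_eq_prod, setIntegral_prod]
    · refine integral_eq_zero_of_ae (Filter.Eventually.of_forall fun y => ?_)
      refine setIntegral_deriv_eq_zero (g := fun z => F (x, y, z)) ?_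
        (hc.comp (by fun_prop : Continuous fun z : ℝ => (x, y, z))) ?_
      · intro z
        exact (hd (x, y, z)).comp_hasDerivAt z ((hasDerivAt_const z x).prodMk
          ((hasDerivAt_const z y).prodMk (hasDerivAt_id z)))
      · have := hp 2 (x, y, -Real.pi)
        simpa [basisVec, hpi] using this
    · exact (hc.comp (by fun_prop : Continuous fun y : ℝ × ℝ => (x, y))).continuousOn
        |>.integrableOn_compact (hcpt.prod hcpt)

theorem _root_.ContDiff.uncurry_comp₂ {E F G H : Type*} [NormedAddCommGroup E] [NormedSpace ℝ E]
    [NormedAddCommGroup F] [NormedSpace ℝ F] [NormedAddCommGroup G] [NormedSpace ℝ G]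
    [NormedAddCommGroup H] [NormedSpace ℝ H] {n : WithTop ℕ∞} {u : F → G → H}
    (hu : ContDiff ℝ n (Function.uncurry u)) {f : E → F} {g : E → G} (hf : ContDiff ℝ n f)
    (hg : ContDiff ℝ n g) : ContDiff ℝ n fun x => u (f x) (g x) :=
  hu.comp (hf.prodMk hg)

/-! ### A vector field transversal to the level set `ε = 0` -/

theorem contDiff_band : ContDiff ℝ ⊤ (Function.uncurry band) := by
  unfold band Function.uncurry
  fun_prop

theorem contDiff_band_right (t : ℝ) : ContDiff ℝ ⊤ (band t) := by
  unfold band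
  fun_prop

theorem continuous_band (t : ℝ) : Continuous (band t) := (contDiff_band_right t).continuous

theorem isPeriodic_band (t : ℝ) : IsPeriodic (band t) := by
  intro i k
  fin_cases i <;> simp [basisVec, band]

theorem abs_band_le {t : ℝ} (ht : t ∈ Ioo (0 : ℝ) 2) (k : ℝ × ℝ × ℝ) : |band t k| ≤ 8 := by
  have h1 := Real.abs_cos_le_one k.1
  have h2 := Real.abs_cos_le_one k.2.1
  have h3 := Real.abs_cos_le_one k.2.2
  have h4 : |t * Real.cos k.2.2| ≤ 2 := by
    rw [abs_mul, abs_of_pos ht.1]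
    nlinarith [ht.1, ht.2, abs_nonneg (Real.cos k.2.2)]
  rw [abs_le] at *
  unfold band
  constructor <;> nlinarith

/-- A vector field `V` on momentum space, with trigonometric polynomials as components, such that
`V · ∇ε` is a polynomial in `ε` that does not vanish at `ε = 0`. It exists since the critical
values `±4 ± 2t`, `±2t` of the band are all different from `0`: the polynomial having these values
as roots lies in the ideal generated by the functions `sin² kᵢ`. -/
noncomputable def transversalField (i : Fin 3) (t : ℝ) (k : ℝ × ℝ × ℝ) : ℝ :=
  let a := Real.cos k.1
  let b := Real.cos k.2.1
  let c := Real.cos k.2.2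
  let E := a + b + t * c
  let S := E ^ 3 + (3 * t ^ 2 - 4) * E + c * (t * (3 * E ^ 2 + t ^ 2 - 4))
  ![Real.sin k.1 * (S * (a + 3 * b)) / 2,
    Real.sin k.2.1 * (S * (b + 3 * a)) / 2,
    Real.sin k.2.2 * (t * (3 * E ^ 2 + t ^ 2 - 4) ^ 2 - S * (t * (3 * E - t * c))) / 2] i

/-- The value of `V · ∇ε` on the level set `ε = 0`. -/
def transversality (t : ℝ) : ℝ := (t * (4 - t ^ 2)) ^ 2

/-- The function `r` with `V · ∇ε = transversality + ε² r`. -/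
noncomputable def transversalityCorrection (t e : ℝ) : ℝ :=
  (t ^ 2 * (9 * e ^ 2 / 4 + 6 * (t ^ 2 - 4)) - (e ^ 2 / 4 + 3 * t ^ 2 - 4) ^ 2) / 4

theorem transversality_pos {t : ℝ} (ht : t ∈ Ioo (0 : ℝ) 2) : 0 < transversality t := by
  have h1 := ht.1
  have h2 := ht.2
  have : 0 < 4 - t ^ 2 := by nlinarith
  unfold transversality
  positivity

theorem contDiff_transversalField (i : Fin 3) :
    ContDiff ℝ ⊤ (Function.uncurry (transversalField i)) := by
  unfold transversalField Function.uncurry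
  fin_cases i <;> simp <;> fun_prop

theorem isPeriodic_transversalField (i : Fin 3) (t : ℝ) : IsPeriodic (transversalField i t) := by
  intro j k
  fin_cases j <;> fin_cases i <;> simp [basisVec, transversalField]

theorem fderiv_band (t : ℝ) (k : ℝ × ℝ × ℝ) (i : Fin 3) : fderiv ℝ (band t) k (basisVec i) =
    ![2 * Real.sin k.1, 2 * Real.sin k.2.1, 2 * t * Real.sin k.2.2] i := by
  have hd := ((contDiff_band_right t).differentiable (by simp) k).hasFDerivAt
  obtain ⟨x, y, z⟩ := k
  fin_cases i
  · refine (hd.comp_hasDerivAt x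
      ((hasDerivAt_id x).prodMk (hasDerivAt_const x (y, z)))).unique ?_
    have := (((Real.hasDerivAt_cos x).add_const (Real.cos y)).const_mul (-2)).sub_const
      (2 * t * Real.cos z)
    exact this.congr_deriv (by simp)
  · refine (hd.comp_hasDerivAt y ((hasDerivAt_const y x).prodMk
          ((hasDerivAt_id y).prodMk (hasDerivAt_const y z)))).unique ?_
    have := (((Real.hasDerivAt_cos y).const_add (Real.cos x)).const_mul (-2)).sub_const
      (2 * t * Real.cos z)
    exact this.congr_deriv (by simp)
  · refine (hd.comp_hasDerivAt z ((hasDerivAt_const z x).prodMk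
          ((hasDerivAt_const z y).prodMk (hasDerivAt_id z)))).unique ?_
    have := ((Real.hasDerivAt_cos z).const_mul (2 * t)).const_sub
      (-2 * (Real.cos x + Real.cos y))
    exact this.congr_deriv (by simp)

theorem sum_transversalField_mul_fderiv_band (t : ℝ) (k : ℝ × ℝ × ℝ) :
    ∑ i, transversalField i t k * fderiv ℝ (band t) k (basisVec i) =
      transversality t + band t k ^ 2 * transversalityCorrection t (band t k) := by
  simp only [Fin.sum_univ_three, fderiv_band, transversalField, transversality,
    transversalityCorrection, band]
  have h1 := Real.sin_sq k.1
  have h2 := Real.sin_sq k.2.1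
  have h3 := Real.sin_sq k.2.2
  simp only [Matrix.cons_val_zero, Matrix.cons_val_one, Matrix.cons_val]
  generalize Real.cos k.1 = a at *
  generalize Real.cos k.2.1 = b at *
  generalize Real.cos k.2.2 = c at *
  -- the left-hand side is linear in the `sin² kᵢ`, which become `1 - cos² kᵢ`
  have hE : ∃ E, E = a + b + t * c := ⟨_, rfl⟩
  obtain ⟨E, hE⟩ := hE
  have hS : ∃ S, S = E ^ 3 + (3 * t ^ 2 - 4) * E + c * (t * (3 * E ^ 2 + t ^ 2 - 4)) := ⟨_, rfl⟩
  obtain ⟨S, hS⟩ := hS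
  rw [← hE, ← hS]
  have h := congrArg₂ (· + ·) (congrArg (S * (a + 3 * b) * ·) h1)
    (congrArg (S * (b + 3 * a) * ·) h2)
  have h' := congrArg
    (t * (t * (3 * E ^ 2 + t ^ 2 - 4) ^ 2 - S * (t * (3 * E - t * c))) * ·) h3
  have hb : b = E - a - t * c := by rw [hE]; ring
  subst hb
  subst hS
  linear_combination h + h'

/-- The operator `u ↦ -div (u V)`, the formal adjoint of the derivative along the transversal
field. -/
noncomputable def adjointDeriv (u : ℝ → ℝ × ℝ × ℝ → ℝ) (t : ℝ) (k : ℝ × ℝ × ℝ) : ℝ :=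
  -∑ i, fderiv ℝ (fun k' => u t k' * transversalField i t k') k (basisVec i)

theorem contDiff_adjointDeriv {u : ℝ → ℝ × ℝ × ℝ → ℝ} (hu : ContDiff ℝ ⊤ (Function.uncurry u)) :
    ContDiff ℝ ⊤ (Function.uncurry (adjointDeriv u)) := by
  unfold adjointDeriv Function.uncurry
  refine ContDiff.neg (ContDiff.sum fun i _ => ?_)
  refine ContDiff.clm_apply ?_ contDiff_const
  have h : ContDiff ℝ ⊤ (Function.uncurry fun (p : ℝ × ℝ × ℝ × ℝ) (k' : ℝ × ℝ × ℝ) =>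
      u p.1 k' * transversalField i p.1 k') := by
    have h1 : ContDiff ℝ ⊤ fun q : (ℝ × ℝ × ℝ × ℝ) × (ℝ × ℝ × ℝ) => q.1.1 := by fun_prop
    exact (hu.uncurry_comp₂ h1 contDiff_snd).mul
      ((contDiff_transversalField i).uncurry_comp₂ h1 contDiff_snd)
  exact ContDiff.fderiv h contDiff_snd (by simp)

theorem isPeriodic_adjointDeriv {u : ℝ → ℝ × ℝ × ℝ → ℝ} {t : ℝ} (hu : IsPeriodic (u t)) :
    IsPeriodic (adjointDeriv u t) := by
  intro j k
  unfold adjointDeriv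
  congr 1
  exact Finset.sum_congr rfl fun i _ =>
    (hu.mul (isPeriodic_transversalField i t)).fderiv (basisVec i) j k

/-- Integration by parts along the transversal field: since `V · ∇(Φ ∘ ε) = (φ ∘ ε) (V · ∇ε)`, it
trades `φ` for its antiderivative `Φ`. -/
theorem integral_comp_band_mul {u : ℝ → ℝ × ℝ × ℝ → ℝ} {t : ℝ}
    (hu : ContDiff ℝ ⊤ (u t)) (hp : IsPeriodic (u t)) {Φ φ : ℝ → ℝ}
    (hΦ : ∀ e, HasDerivAt Φ (φ e) e) (hφ : Continuous φ) :
    ∫ k in brillouinZone, φ (band t k) * (u t k *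
      (transversality t + band t k ^ 2 * transversalityCorrection t (band t k))) =
    ∫ k in brillouinZone, Φ (band t k) * adjointDeriv u t k := by
  have hV : ∀ i, ContDiff ℝ ⊤ (transversalField i t) := fun i =>
    (contDiff_transversalField i).uncurry_comp₂ contDiff_const contDiff_id
  have hw : ∀ i, ContDiff ℝ ⊤ fun k => u t k * transversalField i t k := fun i => hu.mul (hV i)
  have hΦ1 : ContDiff ℝ 1 Φ := by
    rw [contDiff_one_iff_deriv]
    refine ⟨fun e => (hΦ e).differentiableAt, ?_⟩
    rwa [funext fun e => (hΦ e).deriv]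
  have hF : ∀ i, ContDiff ℝ 1 fun k => Φ (band t k) * (u t k * transversalField i t k) := fun i =>
    (hΦ1.comp ((contDiff_band_right t).of_le (by simp))).mul ((hw i).of_le (by simp))
  have hF0 : ∀ i, ∫ k in brillouinZone,
      fderiv ℝ (fun k => Φ (band t k) * (u t k * transversalField i t k)) k (basisVec i) = 0 :=
    fun i => integral_fderiv_eq_zero (hF i) (((isPeriodic_band t).comp Φ).mul
      (hp.mul (isPeriodic_transversalField i t))) i
  have hsum : ∫ k in brillouinZone, ∑ i,
      fderiv ℝ (fun k => Φ (band t k) * (u t k * transversalField i t k)) k (basisVec i) = 0 := by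
    rw [integral_finsetSum]
    · exact Finset.sum_eq_zero fun i _ => hF0 i
    · intro i _
      exact integrableOn_brillouinZone
        (((hF i).continuous_fderiv one_ne_zero).clm_apply continuous_const)
  have hpt : ∀ k, ∑ i,
      fderiv ℝ (fun k => Φ (band t k) * (u t k * transversalField i t k)) k (basisVec i) =
      φ (band t k) * (u t k *
        (transversality t + band t k ^ 2 * transversalityCorrection t (band t k))) -
      Φ (band t k) * adjointDeriv u t k := by
    intro k
    rw [← sum_transversalField_mul_fderiv_band, adjointDeriv, mul_neg, sub_neg_eq_add,
      Finset.mul_sum, Finset.mul_sum, Finset.mul_sum, ← Finset.sum_add_distrib]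
    refine Finset.sum_congr rfl fun i _ => ?_
    have h1 : HasFDerivAt (fun k => Φ (band t k)) (φ (band t k) • fderiv ℝ (band t) k) k :=
      (hΦ _).comp_hasFDerivAt k ((contDiff_band_right t).differentiable (by simp) k).hasFDerivAt
    have h2 := ((hw i).differentiable (by simp) k).hasFDerivAt
    rw [(h1.fun_mul h2).fderiv]
    simp
    ring
  simp only [hpt] at hsum
  have hcband := continuous_band t
  have hcu := hu.continuous
  rw [integral_sub] at hsum
  · linarith
  · refine integrableOn_brillouinZone ?_
    unfold transversalityCorrection
    have := hφ.comp hcband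
    fun_prop
  · refine integrableOn_brillouinZone (((hΦ1.continuous).comp hcband).mul ?_)
    unfold adjointDeriv
    refine Continuous.neg (continuous_finsetSum _ fun i _ => ?_)
    exact ((hw i).continuous_fderiv (by simp)).clm_apply continuous_const

/-! ### Integrals over the Brillouin zone of functions of the energy -/

/-- The first weight `-div V` arising from integration by parts along the transversal field. -/
noncomputable def weightOne : ℝ → ℝ × ℝ × ℝ → ℝ := adjointDeriv fun _ _ => 1

/-- The second weight, arising from a second integration by parts. -/
noncomputable def weightTwo : ℝ → ℝ × ℝ × ℝ → ℝ := adjointDeriv weightOne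

/-- An explicit expression for the density of states at the Fermi level `e = 0`; that it agrees
with the derivative of the integrated density of states is `densityOfStates_zero`. -/
noncomputable def fermiDensity (t : ℝ) : ℝ :=
  ((∫ k in brillouinZone, |band t k| * weightTwo t k) -
    ∫ k in brillouinZone, band t k * |band t k| * weightOne t k *
      transversalityCorrection t (band t k)) / (2 * transversality t ^ 2 * (2 * Real.pi) ^ 3)

theorem contDiff_weightOne : ContDiff ℝ ⊤ (Function.uncurry weightOne) :=
  contDiff_adjointDeriv contDiff_const

theorem contDiff_weightTwo : ContDiff ℝ ⊤ (Function.uncurry weightTwo) :=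
  contDiff_adjointDeriv contDiff_weightOne

theorem contDiff_weightOne_right (t : ℝ) : ContDiff ℝ ⊤ (weightOne t) :=
  contDiff_weightOne.uncurry_comp₂ contDiff_const contDiff_id

theorem contDiff_weightTwo_right (t : ℝ) : ContDiff ℝ ⊤ (weightTwo t) :=
  contDiff_weightTwo.uncurry_comp₂ contDiff_const contDiff_id

theorem isPeriodic_weightOne (t : ℝ) : IsPeriodic (weightOne t) :=
  isPeriodic_adjointDeriv fun _ _ => rfl

/-- For even `φ` with first antiderivative `Φ`, the function `e Φ(e)` differs from `m |e|`,
`m = ∫₀⁸ φ`, by at most the tail of the first moment of `|φ|`. The same holds for the antiderivative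
`e Φ(e) - ∫₀ᵉ s φ(s) ds` of `Φ`, up to a constant. -/
theorem abs_antideriv_sub_le {φ : ℝ → ℝ} (hφ : Continuous φ) (heven : ∀ e, φ (-e) = φ e) {e : ℝ}
    (he : |e| ≤ 8) :
    |e * (∫ s in (0:ℝ)..e, φ s) - |e| * ∫ s in (0:ℝ)..8, φ s| ≤ ∫ s in |e|..8, s * |φ s| ∧
    |e * (∫ s in (0:ℝ)..e, φ s) - (∫ s in (0:ℝ)..e, s * φ s) - |e| * (∫ s in (0:ℝ)..8, φ s) +
      ∫ s in (0:ℝ)..8, s * φ s| ≤ 2 * ∫ s in |e|..8, s * |φ s| := by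
  have h1 : e * (∫ s in (0:ℝ)..e, φ s) = |e| * ∫ s in (0:ℝ)..|e|, φ s := by
    rcases abs_choice e with h | h <;> rw [h]
    have := intervalIntegral.integral_comp_neg (a := 0) (b := -e) φ
    simp only [heven, neg_neg, neg_zero] at this
    rw [this, intervalIntegral.integral_symm]
    ring
  have h2 : (∫ s in (0:ℝ)..e, s * φ s) = ∫ s in (0:ℝ)..|e|, s * φ s := by
    rcases abs_choice e with h | h <;> rw [h]
    have := intervalIntegral.integral_comp_neg (a := 0) (b := -e) (fun s => s * φ s)
    simp only [heven, neg_neg, neg_zero, neg_mul] at this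
    rw [intervalIntegral.integral_neg] at this
    rw [intervalIntegral.integral_symm, ← this, neg_neg]
  rw [h1, h2]
  have ha := abs_nonneg e
  generalize |e| = a at *
  have hi : ∀ x y, IntervalIntegrable φ volume x y := fun x y => hφ.intervalIntegrable x y
  have hsφ : Continuous fun s => s * φ s := by fun_prop
  have hsφ' : Continuous fun s => s * |φ s| := by fun_prop
  have h3 := intervalIntegral.integral_add_adjacent_intervals (hi 0 a) (hi a 8)
  have h4 := intervalIntegral.integral_add_adjacent_intervals
    (hsφ.intervalIntegrable (μ := volume) 0 a) (hsφ.intervalIntegrable a 8)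
  have h5 : |a * ∫ s in a..8, φ s| ≤ ∫ s in a..8, s * |φ s| := by
    rw [← intervalIntegral.integral_const_mul]
    refine (intervalIntegral.abs_integral_le_integral_abs he).trans ?_
    refine intervalIntegral.integral_mono_on he ?_ (hsφ'.intervalIntegrable _ _) ?_
    · exact (by fun_prop : Continuous fun s => |a * φ s|).intervalIntegrable _ _
    · intro s hs
      rw [abs_mul, abs_of_nonneg ha]
      exact mul_le_mul_of_nonneg_right hs.1 (abs_nonneg _)
  have h6 : |∫ s in a..8, s * φ s| ≤ ∫ s in a..8, s * |φ s| := by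
    refine (intervalIntegral.abs_integral_le_integral_abs he).trans ?_
    refine intervalIntegral.integral_mono_on he ?_ (hsφ'.intervalIntegrable _ _) ?_
    · exact (by fun_prop : Continuous fun s => |s * φ s|).intervalIntegrable _ _
    · intro s hs
      rw [abs_mul, abs_of_nonneg (ha.trans hs.1)]
  rw [← h3, ← h4]
  rw [abs_le] at h5 h6 ⊢
  rw [abs_le]
  refine ⟨⟨?_, ?_⟩, ?_, ?_⟩ <;> nlinarith [h5.1, h5.2, h6.1, h6.2]

theorem continuous_tailMoment {φ : ℝ → ℝ} (hφ : Continuous φ) (t : ℝ) :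
    Continuous fun k => ∫ s in |band t k|..8, s * |φ s| := by
  have h : Continuous fun s => s * |φ s| := by fun_prop
  have h1 : (fun k => ∫ s in |band t k|..8, s * |φ s|) =
      fun k => -∫ s in (8:ℝ)..|band t k|, s * |φ s| := by
    funext k
    rw [intervalIntegral.integral_symm]
  rw [h1]
  exact ((intervalIntegral.continuous_primitive (fun a b => h.intervalIntegrable a b) 8).comp
    (continuous_band t).abs).neg

theorem tailMoment_nonneg {t : ℝ} (ht : t ∈ Ioo (0 : ℝ) 2) (φ : ℝ → ℝ) (k : ℝ × ℝ × ℝ) :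
    0 ≤ ∫ s in |band t k|..8, s * |φ s| := by
  refine intervalIntegral.integral_nonneg (abs_band_le ht k) fun s hs => ?_
  have := (abs_nonneg (band t k)).trans hs.1
  positivity

/-- Two integrations by parts turn `φ` into its second antiderivative, for which
`abs_antideriv_sub_le` applies. The constant in the latter drops out, since the second weight has
integral zero. -/
theorem abs_integral_comp_band_sub_le_of_bounds {t B : ℝ} (ht : t ∈ Ioo (0 : ℝ) 2) (hB : 1 ≤ B)
    (h₁ : ∀ k ∈ brillouinZone, |weightOne t k| ≤ B) (h₂ : ∀ k ∈ brillouinZone, |weightTwo t k| ≤ B)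
    (h₃ : ∀ k ∈ brillouinZone, |transversalityCorrection t (band t k)| ≤ B)
    (h₄ : transversality t ≤ B) {φ : ℝ → ℝ} (hφ : Continuous φ) (heven : ∀ e, φ (-e) = φ e) :
    |transversality t ^ 2 * (∫ k in brillouinZone, φ (band t k)) -
      ((∫ k in brillouinZone, |band t k| * weightTwo t k) -
        ∫ k in brillouinZone, band t k * |band t k| * weightOne t k *
          transversalityCorrection t (band t k)) * ∫ s in (0:ℝ)..8, φ s| ≤
      10 * B ^ 2 * ∫ k in brillouinZone, (band t k ^ 2 * |φ (band t k)| +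
        ∫ s in |band t k|..8, s * |φ s|) := by
  set M := transversality t with hM
  have hM0 : 0 < M := transversality_pos ht
  set m := ∫ s in (0:ℝ)..8, φ s with hm
  set c := ∫ s in (0:ℝ)..8, s * φ s with hc
  set Φ : ℝ → ℝ := fun e => ∫ s in (0:ℝ)..e, φ s with hΦ
  set Ψ : ℝ → ℝ := fun e => e * Φ e - ∫ s in (0:ℝ)..e, s * φ s with hΨ
  have hsφ : Continuous fun s => s * φ s := by fun_prop
  have hΦd : ∀ e, HasDerivAt Φ (φ e) e := fun e =>
    intervalIntegral.integral_hasDerivAt_right (hφ.intervalIntegrable _ _)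
      (hφ.stronglyMeasurableAtFilter _ _) hφ.continuousAt
  have hΨd : ∀ e, HasDerivAt Ψ (Φ e) e := fun e => by
    have h1 : HasDerivAt (fun e => ∫ s in (0:ℝ)..e, s * φ s) (e * φ e) e :=
      intervalIntegral.integral_hasDerivAt_right (hsφ.intervalIntegrable _ _)
        (hsφ.stronglyMeasurableAtFilter _ _) hsφ.continuousAt
    exact (((hasDerivAt_id e).mul (hΦd e)).sub h1).congr_deriv (by simp)
  have hΦc : Continuous Φ := continuous_iff_continuousAt.2 fun e => (hΦd e).continuousAt
  have hΨc : Continuous Ψ := continuous_iff_continuousAt.2 fun e => (hΨd e).continuousAt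
  have hε := continuous_band t
  have hr : Continuous fun k => transversalityCorrection t (band t k) := by
    unfold transversalityCorrection
    fun_prop
  have hw1 := (contDiff_weightOne_right t).continuous
  have hw2 := (contDiff_weightTwo_right t).continuous
  have hφε := hφ.comp hε
  have hΦε := hΦc.comp hε
  have hΨε := hΨc.comp hε
  simp only [Function.comp_def] at hφε hΦε hΨε
  -- the three identities obtained by integration by parts
  have e1 := integral_comp_band_mul (u := fun _ _ => 1) (t := t) contDiff_const
    (fun _ _ => rfl) hΦd hφ
  have e2 := integral_comp_band_mul (contDiff_weightOne_right t) (isPeriodic_weightOne t) hΨd hΦc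
  have e3 := integral_comp_band_mul (contDiff_weightOne_right t) (isPeriodic_weightOne t)
    (Φ := fun _ => 1) (φ := fun _ => 0) (fun e => hasDerivAt_const e 1) continuous_const
  change _ = ∫ k in brillouinZone, Φ (band t k) * weightOne t k at e1
  change _ = ∫ k in brillouinZone, Ψ (band t k) * weightTwo t k at e2
  change _ = ∫ k in brillouinZone, 1 * weightTwo t k at e3
  simp only [zero_mul, one_mul, integral_zero] at e1 e3
  have e1' : ∫ k in brillouinZone, φ (band t k) * (M + band t k ^ 2 *
      transversalityCorrection t (band t k)) = M * (∫ k in brillouinZone, φ (band t k)) +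
      ∫ k in brillouinZone, φ (band t k) * band t k ^ 2 *
        transversalityCorrection t (band t k) := by
    rw [← integral_const_mul, ← integral_add]
    · congr 1; funext k; ring
    · exact integrableOn_brillouinZone (by fun_prop)
    · exact integrableOn_brillouinZone (by fun_prop)
  have e2' : ∫ k in brillouinZone, Φ (band t k) * (weightOne t k * (M + band t k ^ 2 *
      transversalityCorrection t (band t k))) =
      M * (∫ k in brillouinZone, Φ (band t k) * weightOne t k) +
      ∫ k in brillouinZone, Φ (band t k) * weightOne t k * band t k ^ 2 *
        transversalityCorrection t (band t k) := by
    rw [← integral_const_mul, ← integral_add]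
    · congr 1; funext k; ring
    · exact integrableOn_brillouinZone (by fun_prop)
    · exact integrableOn_brillouinZone (by fun_prop)
  have e4 : M ^ 2 * (∫ k in brillouinZone, φ (band t k)) -
      ((∫ k in brillouinZone, |band t k| * weightTwo t k) -
        ∫ k in brillouinZone, band t k * |band t k| * weightOne t k *
          transversalityCorrection t (band t k)) * m =
      ∫ k in brillouinZone, ((Ψ (band t k) - |band t k| * m + c) * weightTwo t k -
        (band t k * Φ (band t k) - |band t k| * m) * (band t k * weightOne t k *
          transversalityCorrection t (band t k)) -
        M * (φ (band t k) * band t k ^ 2 * transversalityCorrection t (band t k))) := by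
    have : ∀ k, ((Ψ (band t k) - |band t k| * m + c) * weightTwo t k -
        (band t k * Φ (band t k) - |band t k| * m) * (band t k * weightOne t k *
          transversalityCorrection t (band t k)) -
        M * (φ (band t k) * band t k ^ 2 * transversalityCorrection t (band t k))) =
        Ψ (band t k) * weightTwo t k - m * (|band t k| * weightTwo t k) + c * weightTwo t k -
        Φ (band t k) * weightOne t k * band t k ^ 2 * transversalityCorrection t (band t k) +
        m * (band t k * |band t k| * weightOne t k * transversalityCorrection t (band t k)) -
        M * (φ (band t k) * band t k ^ 2 * transversalityCorrection t (band t k)) := by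
      intro k; ring
    simp only [this]
    rw [integral_sub, integral_add, integral_sub, integral_add, integral_sub, integral_const_mul,
      integral_const_mul, integral_const_mul, integral_const_mul, ← e3, ← e2, e2', ← e1, e1']
    · ring
    all_goals exact integrableOn_brillouinZone (by fun_prop)
  rw [e4, ← integral_const_mul]
  have hT := continuous_tailMoment hφ t
  refine (abs_integral_le_integral_abs).trans (setIntegral_mono_on ?_ ?_
    measurableSet_brillouinZone fun k hk => ?_)
  · exact integrableOn_brillouinZone (by fun_prop)
  · exact integrableOn_brillouinZone (by fun_prop)
  obtain ⟨b1, b2⟩ := abs_antideriv_sub_le hφ heven (abs_band_le ht k)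
  have b3 := tailMoment_nonneg ht φ k
  have hε8 := abs_band_le ht k
  have h1 := h₁ k hk
  have h2 := h₂ k hk
  have h3 := h₃ k hk
  set R := ∫ s in |band t k|..8, s * |φ s|
  have x1 : |(Ψ (band t k) - |band t k| * m + c) * weightTwo t k| ≤ 2 * R * B := by
    rw [abs_mul]
    exact mul_le_mul b2 h2 (abs_nonneg _) (by positivity)
  have x2 : |(band t k * Φ (band t k) - |band t k| * m) * (band t k * weightOne t k *
      transversalityCorrection t (band t k))| ≤ R * (8 * B * B) := by
    rw [abs_mul, abs_mul, abs_mul]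
    gcongr
  have x3 : |M * (φ (band t k) * band t k ^ 2 * transversalityCorrection t (band t k))| ≤
      B * (|φ (band t k)| * band t k ^ 2 * B) := by
    rw [abs_mul, abs_mul, abs_mul, abs_of_pos hM0, abs_of_nonneg (sq_nonneg (band t k))]
    gcongr
  have x4 : R * B ≤ R * B ^ 2 := by
    gcongr
    nlinarith
  have x5 : 0 ≤ |φ (band t k)| * band t k ^ 2 * B ^ 2 := by positivity
  refine (abs_sub _ _).trans ?_
  refine (add_le_add (abs_sub _ _) le_rfl).trans ?_
  nlinarith

/-- For even `φ` the integral of `φ(ε(k))` over the Brillouin zone is `(2π)³ N ∫ φ`, where `N` is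
the density of states at the Fermi level, up to an error that only involves second moments. -/
theorem exists_abs_integral_comp_band_sub_le {K : Set ℝ} (hK : IsCompact K)
    (hK2 : K ⊆ Ioo (0 : ℝ) 2) : ∃ C : ℝ, 0 < C ∧ ∀ t ∈ K, ∀ φ : ℝ → ℝ, Continuous φ →
      (∀ e, φ (-e) = φ e) →
      |(∫ k in brillouinZone, φ (band t k)) -
        (2 * Real.pi) ^ 3 * (2 * fermiDensity t * ∫ s in (0:ℝ)..8, φ s)| ≤
      C * ∫ k in brillouinZone, (band t k ^ 2 * |φ (band t k)| +
        ∫ s in |band t k|..8, s * |φ s|) := by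
  have hKB := hK.prod isCompact_brillouinZone
  obtain ⟨B₁, hB₁⟩ := hKB.exists_bound_of_continuousOn
    (contDiff_weightOne.continuous).continuousOn
  obtain ⟨B₂, hB₂⟩ := hKB.exists_bound_of_continuousOn
    (contDiff_weightTwo.continuous).continuousOn
  obtain ⟨B₃, hB₃⟩ := hKB.exists_bound_of_continuousOn
    (f := fun p : ℝ × ℝ × ℝ × ℝ => transversalityCorrection p.1 (band p.1 p.2)) (by
      have := contDiff_band.continuous
      have h : Continuous fun p : ℝ × ℝ × ℝ × ℝ => band p.1 p.2 := this
      unfold transversalityCorrection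
      fun_prop)
  obtain ⟨B₄, hB₄⟩ := hK.exists_bound_of_continuousOn (f := transversality) (by
    unfold transversality; fun_prop)
  obtain ⟨B₅, hB₅⟩ := hK.exists_bound_of_continuousOn (f := fun t => 1 / transversality t ^ 2) (by
    refine continuousOn_const.div ?_ fun t ht => pow_ne_zero 2 (transversality_pos (hK2 ht)).ne'
    unfold transversality; fun_prop)
  set B := 1 + |B₁| + |B₂| + |B₃| + |B₄| with hB
  have a1 := abs_nonneg B₁
  have a2 := abs_nonneg B₂
  have a3 := abs_nonneg B₃
  have a4 := abs_nonneg B₄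
  have a5 := abs_nonneg B₅
  have hB1 : 1 ≤ B := by linarith
  refine ⟨10 * B ^ 2 * (1 + |B₅|), by positivity, fun t ht φ hφ heven => ?_⟩
  have key := abs_integral_comp_band_sub_le_of_bounds (hK2 ht) hB1
    (fun k hk => (hB₁ (t, k) ⟨ht, hk⟩).trans (by linarith [le_abs_self B₁]))
    (fun k hk => (hB₂ (t, k) ⟨ht, hk⟩).trans (by linarith [le_abs_self B₂]))
    (fun k hk => (hB₃ (t, k) ⟨ht, hk⟩).trans (by linarith [le_abs_self B₃]))
    ((le_abs_self _).trans ((hB₄ t ht).trans (by linarith [le_abs_self B₄]))) hφ heven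
  have hM := transversality_pos (hK2 ht)
  have hM5 : 1 / transversality t ^ 2 ≤ 1 + |B₅| :=
    (le_abs_self _).trans ((hB₅ t ht).trans (by linarith [le_abs_self B₅]))
  set X := ∫ k in brillouinZone, (band t k ^ 2 * |φ (band t k)| +
        ∫ s in |band t k|..8, s * |φ s|) with hX
  have hX0 : 0 ≤ X := integral_nonneg fun k => by
    have := tailMoment_nonneg (hK2 ht) φ k
    positivity
  have hpi := Real.pi_pos
  have e : (∫ k in brillouinZone, φ (band t k)) -
        (2 * Real.pi) ^ 3 * (2 * fermiDensity t * ∫ s in (0:ℝ)..8, φ s) =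
      1 / transversality t ^ 2 * (transversality t ^ 2 * (∫ k in brillouinZone, φ (band t k)) -
      ((∫ k in brillouinZone, |band t k| * weightTwo t k) -
        ∫ k in brillouinZone, band t k * |band t k| * weightOne t k *
          transversalityCorrection t (band t k)) * ∫ s in (0:ℝ)..8, φ s) := by
    unfold fermiDensity
    field_simp
  rw [e, abs_mul, abs_of_pos (by positivity)]
  calc _ ≤ (1 + |B₅|) * (10 * B ^ 2 * X) := by gcongr
    _ = _ := by ring

theorem exists_fermiDensity_le {K : Set ℝ} (hK : IsCompact K)
    (hK2 : K ⊆ Ioo (0 : ℝ) 2) : ∃ C : ℝ, 0 < C ∧ ∀ t ∈ K, fermiDensity t ≤ C := by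
  obtain ⟨C, hC, h⟩ := exists_abs_integral_comp_band_sub_le hK hK2
  -- the asymptotic formula for `φ = 1`
  set v := ∫ _ in brillouinZone, (1 : ℝ) with hv
  have hv0 : 0 ≤ v := integral_nonneg fun _ => zero_le_one
  refine ⟨(v + C * (96 * v)) / ((2 * Real.pi) ^ 3 * 16) + 1, by positivity, fun t ht => ?_⟩
  have h1 := h t ht (fun _ => 1) continuous_const fun _ => rfl
  simp only [intervalIntegral.integral_const, smul_eq_mul, abs_one, mul_one, ← hv, sub_zero] at h1
  have h2 : ∫ k in brillouinZone, (band t k ^ 2 + ∫ s in |band t k|..8, s) ≤ 96 * v := by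
    rw [hv, ← integral_const_mul]
    have hε := continuous_band t
    simp only [integral_id]
    refine setIntegral_mono_on (integrableOn_brillouinZone (by fun_prop))
      (integrableOn_brillouinZone (by fun_prop)) measurableSet_brillouinZone fun k _ => ?_
    have := abs_band_le (hK2 ht) k
    nlinarith [abs_nonneg (band t k), sq_abs (band t k)]
  have h3 : C * ∫ k in brillouinZone, (band t k ^ 2 + ∫ s in |band t k|..8, s) ≤ C * (96 * v) := by
    gcongr
  have h4 := (abs_le.1 h1).1
  have hpi : 0 < (2 * Real.pi) ^ 3 := by have := Real.pi_pos; positivity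
  rw [← sub_nonneg]
  have h5 : fermiDensity t ≤ (v + C * (96 * v)) / ((2 * Real.pi) ^ 3 * 16) := by
    rw [le_div_iff₀ (by positivity)]
    nlinarith
  linarith

/-! ### The density of states at the Fermi level -/

/-- The distribution of the band energies, a finite measure on the real line of total mass
`(2π)³`. -/
noncomputable def energyMeasure (t : ℝ) : Measure ℝ := (volume.restrict brillouinZone).map (band t)

instance : IsFiniteMeasure (volume.restrict brillouinZone) :=
  ⟨by simpa using isCompact_brillouinZone.measure_lt_top⟩

instance (t : ℝ) : IsFiniteMeasure (energyMeasure t) := by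
  unfold energyMeasure; infer_instance

theorem measurable_band (t : ℝ) : Measurable (band t) := (continuous_band t).measurable

theorem integral_energyMeasure (t : ℝ) {f : ℝ → ℝ} (hf : Measurable f) :
    ∫ e, f e ∂energyMeasure t = ∫ k in brillouinZone, f (band t k) :=
  integral_map (measurable_band t).aemeasurable hf.aestronglyMeasurable

/-- A shift by `π` in one momentum component. -/
theorem setIntegral_comp_cos_neg (g : ℝ → ℝ) :
    ∫ x in Icc (-Real.pi) Real.pi, g (Real.cos x) =
      ∫ x in Icc (-Real.pi) Real.pi, g (-Real.cos x) := by
  have hle : -Real.pi ≤ Real.pi := by linarith [Real.pi_pos]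
  rw [integral_Icc_eq_integral_Ioc, integral_Icc_eq_integral_Ioc,
    ← intervalIntegral.integral_of_le hle, ← intervalIntegral.integral_of_le hle]
  have hp : Function.Periodic (fun x => g (-Real.cos x)) (2 * Real.pi) := fun x => by simp
  have h1 := hp.intervalIntegral_add_eq (-Real.pi) (-Real.pi + Real.pi)
  have h2 := intervalIntegral.integral_comp_add_right (a := -Real.pi) (b := Real.pi)
    (fun x => g (-Real.cos x)) Real.pi
  simp only [Real.cos_add_pi, neg_neg] at h2
  rw [h2, show Real.pi + Real.pi = -Real.pi + Real.pi + 2 * Real.pi by ring, ← h1]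
  congr 1
  ring

theorem integrableOn_comp_band {f : ℝ → ℝ} (hf : Measurable f) {M : ℝ} (hM : ∀ x, |f x| ≤ M)
    (t : ℝ) : IntegrableOn (fun k => f (band t k)) brillouinZone :=
  Measure.integrableOn_of_bounded isCompact_brillouinZone.measure_lt_top.ne
    (hf.comp (measurable_band t)).aestronglyMeasurable
    (Filter.Eventually.of_forall fun _ => hM _)

theorem setIntegral_comp_band {f : ℝ → ℝ} (hf : Measurable f) {M : ℝ} (hM : ∀ x, |f x| ≤ M)
    (t : ℝ) : ∫ k in brillouinZone, f (band t k) =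
      ∫ x in Icc (-Real.pi) Real.pi, ∫ y in Icc (-Real.pi) Real.pi,
        ∫ z in Icc (-Real.pi) Real.pi,
          f (-2 * (Real.cos x + Real.cos y) - 2 * t * Real.cos z) := by
  have hI := integrableOn_comp_band hf hM t
  rw [Measure.volume_eq_prod] at hI ⊢
  rw [brillouinZone, setIntegral_prod _ hI]
  congr 1
  funext x
  rw [Measure.volume_eq_prod, setIntegral_prod]
  · simp only [band]
  · rw [← Measure.volume_eq_prod]
    refine Measure.integrableOn_of_bounded (isCompact_Icc.prod isCompact_Icc).measure_lt_top.ne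
      ?_ (M := M) (Filter.Eventually.of_forall fun k => hM _)
    exact (hf.comp ((measurable_band t).comp
      (measurable_prodMk_left (x := x)))).aestronglyMeasurable

theorem setIntegral_comp_neg_band {f : ℝ → ℝ} (hf : Measurable f) {M : ℝ} (hM : ∀ x, |f x| ≤ M)
    (t : ℝ) : ∫ k in brillouinZone, f (-band t k) = ∫ k in brillouinZone, f (band t k) := by
  rw [setIntegral_comp_band hf hM t,
    setIntegral_comp_band (f := fun x => f (-x)) (hf.comp measurable_neg) (fun x => hM _) t]
  rw [setIntegral_comp_cos_neg fun a => ∫ y in Icc (-Real.pi) Real.pi,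
        ∫ z in Icc (-Real.pi) Real.pi, f (-2 * (a + Real.cos y) - 2 * t * Real.cos z)]
  congr 1
  funext x
  rw [setIntegral_comp_cos_neg fun b => ∫ z in Icc (-Real.pi) Real.pi,
    f (-2 * (-Real.cos x + b) - 2 * t * Real.cos z)]
  congr 1
  funext y
  rw [setIntegral_comp_cos_neg fun c => f (-2 * (-Real.cos x + -Real.cos y) - 2 * t * c)]
  congr 1
  funext z
  congr 1
  ring

/-- Particle-hole symmetry: the energy distribution is symmetric, since `ε` changes its sign when
all momenta are shifted by `π`. -/
theorem energyMeasure_real_neg (t : ℝ) {S : Set ℝ} (hS : MeasurableSet S) :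
    (energyMeasure t).real (-S) = (energyMeasure t).real S := by
  have hm : Measurable (S.indicator (1 : ℝ → ℝ)) := measurable_one.indicator hS
  have hb : ∀ x, |S.indicator (1 : ℝ → ℝ) x| ≤ 1 := by
    intro x
    by_cases h : x ∈ S <;> simp [h]
  rw [← integral_indicator_one hS, ← integral_indicator_one hS.neg, integral_energyMeasure t hm,
    integral_energyMeasure t (measurable_one.indicator hS.neg),
    ← setIntegral_comp_neg_band hm hb]
  rfl

theorem integratedDOS_eq (t e : ℝ) :
    integratedDOS t e = (energyMeasure t).real (Iic e) / (2 * Real.pi) ^ 3 := by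
  have h : {k ∈ brillouinZone | band t k ≤ e} = band t ⁻¹' (Iic e) ∩ brillouinZone := by
    ext k; simp [and_comm]
  rw [integratedDOS, h, energyMeasure, map_measureReal_apply (measurable_band t) measurableSet_Iic,
    Measure.real, Measure.restrict_apply ((measurable_band t) measurableSet_Iic)]

/-- A continuous cut-off: `1` on `[-a, a]`, `0` outside `[-(a + δ), a + δ]`. -/
noncomputable def trapezoid (a δ e : ℝ) : ℝ := max 0 (min 1 ((a + δ - |e|) / δ))

theorem continuous_trapezoid (a δ : ℝ) : Continuous (trapezoid a δ) := by
  unfold trapezoid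
  fun_prop

theorem trapezoid_nonneg (a δ e : ℝ) : 0 ≤ trapezoid a δ e := le_max_left _ _

theorem trapezoid_le_one (a δ e : ℝ) : trapezoid a δ e ≤ 1 := max_le zero_le_one (min_le_left _ _)

theorem trapezoid_eq_one {a δ e : ℝ} (hδ : 0 < δ) (he : |e| ≤ a) : trapezoid a δ e = 1 := by
  have : 1 ≤ (a + δ - |e|) / δ := by rw [le_div_iff₀ hδ]; linarith
  simp [trapezoid, this]

theorem trapezoid_eq_zero {a δ e : ℝ} (hδ : 0 < δ) (he : a + δ ≤ |e|) : trapezoid a δ e = 0 := by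
  have h : (a + δ - |e|) / δ ≤ 0 := div_nonpos_of_nonpos_of_nonneg (by linarith) hδ.le
  exact max_eq_left ((min_le_right _ _).trans h)

theorem integral_trapezoid_mem {a δ : ℝ} (ha : 0 ≤ a) (hδ : 0 < δ) (h8 : a + δ ≤ 8) :
    (∫ s in (0:ℝ)..8, trapezoid a δ s) ∈ Icc a (a + δ) := by
  have hc := continuous_trapezoid a δ
  have hi : ∀ x y, IntervalIntegrable (trapezoid a δ) volume x y := fun x y =>
    hc.intervalIntegrable x y
  have e1 := intervalIntegral.integral_add_adjacent_intervals (hi 0 a) (hi a 8)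
  have e2 := intervalIntegral.integral_add_adjacent_intervals (hi 0 (a + δ)) (hi (a + δ) 8)
  have h1 : ∫ s in (0:ℝ)..a, trapezoid a δ s = a := by
    rw [intervalIntegral.integral_congr (g := fun _ => (1 : ℝ))]
    · simp
    · intro s hs
      rw [uIcc_of_le ha] at hs
      exact trapezoid_eq_one hδ (by rw [abs_of_nonneg hs.1]; exact hs.2)
  have h2 : ∫ s in (a + δ)..8, trapezoid a δ s = 0 := by
    rw [intervalIntegral.integral_congr (g := fun _ => (0 : ℝ))]
    · simp
    · intro s hs
      rw [uIcc_of_le h8] at hs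
      exact trapezoid_eq_zero hδ (hs.1.trans (le_abs_self s))
  have h3 : 0 ≤ ∫ s in a..8, trapezoid a δ s :=
    intervalIntegral.integral_nonneg (by linarith) fun s _ => trapezoid_nonneg a δ s
  have h4 : ∫ s in (0:ℝ)..(a + δ), trapezoid a δ s ≤ ∫ s in (0:ℝ)..(a + δ), (1 : ℝ) :=
    intervalIntegral.integral_mono_on (by linarith) (hi _ _) (by simp) fun s _ =>
      trapezoid_le_one a δ s
  simp only [intervalIntegral.integral_const, smul_eq_mul, mul_one, sub_zero] at h4
  constructor <;> linarith

/-- The measure of a small energy window around the Fermi level, tested with cut-offs. -/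
theorem exists_abs_integral_trapezoid_sub_le {t : ℝ} (ht : t ∈ Ioo (0 : ℝ) 2) :
    ∃ C : ℝ, 0 < C ∧ ∀ a δ : ℝ, 0 ≤ a → 0 < δ → a + δ ≤ 2 →
      |(∫ e, trapezoid a δ e ∂energyMeasure t) - (2 * Real.pi) ^ 3 * (2 * fermiDensity t * a)| ≤
        C * (δ + (a + δ) ^ 2) := by
  obtain ⟨C, hC, h⟩ := exists_abs_integral_comp_band_sub_le (K := {t}) isCompact_singleton
    (by simpa using ht)
  set N := (2 * Real.pi) ^ 3 * (2 * fermiDensity t) with hN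
  set v := ∫ _ in brillouinZone, (1 : ℝ) with hv
  have hv0 : 0 ≤ v := integral_nonneg fun _ => zero_le_one
  refine ⟨|N| + C * (9 * v) + 1, by positivity, fun a δ ha hδ h2 => ?_⟩
  have hc := continuous_trapezoid a δ
  have h1 := h t rfl _ hc fun e => by simp [trapezoid]
  obtain ⟨m1, m2⟩ := integral_trapezoid_mem ha hδ (by linarith)
  rw [integral_energyMeasure t hc.measurable]
  set m := ∫ s in (0:ℝ)..8, trapezoid a δ s
  have hε := continuous_band t
  have hE : ∫ k in brillouinZone, (band t k ^ 2 * |trapezoid a δ (band t k)| +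
      ∫ s in |band t k|..8, s * |trapezoid a δ s|) ≤ 9 * v * (a + δ) ^ 2 := by
    have : 9 * v * (a + δ) ^ 2 = ∫ k in brillouinZone, 9 * (a + δ) ^ 2 * (1 : ℝ) := by
      rw [integral_const_mul]; ring
    rw [this]
    refine setIntegral_mono_on ?_ (integrableOn_brillouinZone (by fun_prop))
      measurableSet_brillouinZone fun k _ => ?_
    · have := continuous_tailMoment hc t
      exact integrableOn_brillouinZone (by fun_prop)
    have hk := abs_band_le ht k
    have hk0 := abs_nonneg (band t k)
    have p1 : band t k ^ 2 * |trapezoid a δ (band t k)| ≤ (a + δ) ^ 2 := by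
      rw [abs_of_nonneg (trapezoid_nonneg _ _ _)]
      rcases le_total (a + δ) |band t k| with h | h
      · rw [trapezoid_eq_zero hδ h]; simp; positivity
      · calc band t k ^ 2 * trapezoid a δ (band t k) ≤ band t k ^ 2 * 1 := by
              gcongr; exact trapezoid_le_one _ _ _
          _ = |band t k| ^ 2 := by rw [sq_abs, mul_one]
          _ ≤ _ := by gcongr
    -- `s τ(s) ≤ (a + δ) τ(s)`, and the integral of `τ` is at most `a + δ`
    have p2 : ∫ s in |band t k|..8, s * |trapezoid a δ s| ≤ (a + δ) ^ 2 := by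
      have i1 : ∀ x y, IntervalIntegrable (fun s => (a + δ) * trapezoid a δ s) volume x y :=
        fun x y => (by fun_prop : Continuous fun s => (a + δ) * trapezoid a δ s
          ).intervalIntegrable x y
      calc _ ≤ ∫ s in |band t k|..8, (a + δ) * trapezoid a δ s := by
            refine intervalIntegral.integral_mono_on hk ?_ (i1 _ _) fun s hs => ?_
            · exact (by fun_prop : Continuous fun s => s * |trapezoid a δ s|
                ).intervalIntegrable _ _
            · rw [abs_of_nonneg (trapezoid_nonneg _ _ _)]
              rcases le_total (a + δ) s with h | h
              · rw [trapezoid_eq_zero hδ (h.trans (le_abs_self s))]; simp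
              · exact mul_le_mul_of_nonneg_right h (trapezoid_nonneg _ _ _)
        _ ≤ ∫ s in (0:ℝ)..8, (a + δ) * trapezoid a δ s := by
            rw [← intervalIntegral.integral_add_adjacent_intervals (i1 0 |band t k|) (i1 _ 8)]
            have : 0 ≤ ∫ s in (0:ℝ)..|band t k|, (a + δ) * trapezoid a δ s :=
              intervalIntegral.integral_nonneg hk0 fun s _ => by
                have := trapezoid_nonneg a δ s
                positivity
            linarith
        _ ≤ _ := by
            rw [intervalIntegral.integral_const_mul, sq]
            gcongr
    nlinarith
  have h3 := h1.trans (mul_le_mul_of_nonneg_left hE hC.le)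
  have h4 : |N * (m - a)| ≤ |N| * δ := by
    rw [abs_mul]
    gcongr
    rw [abs_of_nonneg (by linarith)]
    linarith
  have e1 : (2 * Real.pi) ^ 3 * (2 * fermiDensity t * m) = N * m := by rw [hN]; ring
  have e2 : (2 * Real.pi) ^ 3 * (2 * fermiDensity t * a) = N * a := by rw [hN]; ring
  rw [e1] at h3
  rw [e2]
  have h5 : 0 ≤ |N| * (a + δ) ^ 2 := by positivity
  have h6 : 0 ≤ C * (9 * v) * δ := by positivity
  rw [abs_le] at h3 h4 ⊢
  constructor <;> nlinarith [sq_nonneg (a + δ)]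

/-- The measure of the energy window `[-h, h]` is `2 (2π)³ N h + O(h²)`, with or without the
endpoints. It is sandwiched between cut-offs with a slope of width `h²`. -/
theorem exists_energyMeasure_window {t : ℝ} (ht : t ∈ Ioo (0 : ℝ) 2) :
    ∃ C : ℝ, 0 < C ∧ ∀ h ∈ Ioo (0 : ℝ) 1,
      (energyMeasure t).real (Icc (-h) h) ≤
        (2 * Real.pi) ^ 3 * (2 * fermiDensity t * h) + C * h ^ 2 ∧
      (2 * Real.pi) ^ 3 * (2 * fermiDensity t * h) - C * h ^ 2 ≤
        (energyMeasure t).real (Ioo (-h) h) := by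
  obtain ⟨C, hC, H⟩ := exists_abs_integral_trapezoid_sub_le ht
  set N := (2 * Real.pi) ^ 3 * (2 * fermiDensity t) with hN
  have eN : ∀ a, (2 * Real.pi) ^ 3 * (2 * fermiDensity t * a) = N * a := fun a => by rw [hN]; ring
  refine ⟨5 * C + |N|, by positivity, fun h hh => ?_⟩
  have hh0 := hh.1
  have hh1 := hh.2
  have hh2 : 0 < h ^ 2 := by positivity
  have hh3 : h ^ 2 < h := by nlinarith
  have hint : ∀ a δ, Integrable (trapezoid a δ) (energyMeasure t) := fun a δ =>
    Integrable.of_bound (continuous_trapezoid a δ).aestronglyMeasurable 1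
      (Filter.Eventually.of_forall fun e => by
        rw [Real.norm_eq_abs, abs_of_nonneg (trapezoid_nonneg _ _ _)]
        exact trapezoid_le_one _ _ _)
  have hind : ∀ S, MeasurableSet S → Integrable (S.indicator (1 : ℝ → ℝ)) (energyMeasure t) :=
    fun S hS => (integrable_const (1 : ℝ)).indicator hS
  rw [eN, ← integral_indicator_one measurableSet_Icc, ← integral_indicator_one measurableSet_Ioo]
  have hNa := neg_abs_le N
  have hNb := le_abs_self N
  constructor
  · have h1 := H h (h ^ 2) hh0.le hh2 (by linarith)
    rw [eN] at h1
    have h2 : ∫ e, (Icc (-h) h).indicator (1 : ℝ → ℝ) e ∂energyMeasure t ≤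
        ∫ e, trapezoid h (h ^ 2) e ∂energyMeasure t := by
      refine integral_mono (hind _ measurableSet_Icc) (hint _ _) fun e => ?_
      by_cases he : e ∈ Icc (-h) h
      · rw [indicator_of_mem he, trapezoid_eq_one hh2 (abs_le.2 he)]; rfl
      · rw [indicator_of_notMem he]; exact trapezoid_nonneg _ _ _
    have h3 := (abs_le.1 h1).2
    have h4 : (h + h ^ 2) ^ 2 ≤ 4 * h ^ 2 := by nlinarith
    nlinarith [abs_nonneg N]
  · have h1 := H (h - h ^ 2) (h ^ 2) (by linarith) hh2 (by linarith)
    rw [eN] at h1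
    have h2 : ∫ e, trapezoid (h - h ^ 2) (h ^ 2) e ∂energyMeasure t ≤
        ∫ e, (Ioo (-h) h).indicator (1 : ℝ → ℝ) e ∂energyMeasure t := by
      refine integral_mono (hint _ _) (hind _ measurableSet_Ioo) fun e => ?_
      by_cases he : e ∈ Ioo (-h) h
      · rw [indicator_of_mem he]; exact trapezoid_le_one _ _ _
      · rw [indicator_of_notMem he, trapezoid_eq_zero hh2]
        rw [sub_add_cancel]
        by_contra hlt
        exact he (abs_lt.1 (not_le.1 hlt))
    have h3 := (abs_le.1 h1).1
    have h4 : N * h ^ 2 ≤ |N| * h ^ 2 := by gcongr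
    have h5 : (h - h ^ 2 + h ^ 2) ^ 2 = h ^ 2 := by ring
    rw [h5] at h3
    nlinarith

theorem energyMeasure_real_singleton_zero {t : ℝ} (ht : t ∈ Ioo (0 : ℝ) 2) :
    (energyMeasure t).real {0} = 0 := by
  obtain ⟨C, hC, H⟩ := exists_energyMeasure_window ht
  refine le_antisymm (le_of_forall_pos_le_add fun η hη => ?_) measureReal_nonneg
  set M := |(2 * Real.pi) ^ 3 * (2 * fermiDensity t)| + C + 1 with hM
  have hM0 : 0 < M := by positivity
  set h := min (1 / 2) (η / M) with hh
  have h0 : 0 < h := by positivity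
  have h1 : h < 1 := (min_le_left _ _).trans_lt (by norm_num)
  have h2 : h * M ≤ η := by
    rw [← le_div_iff₀ hM0]; exact min_le_right _ _
  have h3 := (H h ⟨h0, h1⟩).1
  have h4 : (energyMeasure t).real {0} ≤ (energyMeasure t).real (Icc (-h) h) :=
    measureReal_mono (by simp [h0.le])
  have h5 := mul_le_mul_of_nonneg_right
    (le_abs_self ((2 * Real.pi) ^ 3 * (2 * fermiDensity t))) h0.le
  have h6 : C * h ^ 2 ≤ C * h := by
    gcongr
    nlinarith
  rw [hM] at h2
  linarith

theorem hasDerivAt_integratedDOS {t : ℝ} (ht : t ∈ Ioo (0 : ℝ) 2) :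
    HasDerivAt (integratedDOS t) (fermiDensity t) 0 := by
  obtain ⟨C, hC, H⟩ := exists_energyMeasure_window ht
  have h0 := energyMeasure_real_singleton_zero ht
  set μ := energyMeasure t with hμ
  set N := (2 * Real.pi) ^ 3 * fermiDensity t with hN
  have hpi : 0 < (2 * Real.pi) ^ 3 := by have := Real.pi_pos; positivity
  -- the increments of the distribution function over `[0, h]` and `[-h, 0]`
  have hkey : ∀ h ∈ Ioo (0 : ℝ) 1, |μ.real (Ioc 0 h) - N * h| ≤ C * h ^ 2 ∧
      |μ.real (Ioc (-h) 0) - N * h| ≤ C * h ^ 2 := by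
    intro h hh
    obtain ⟨H1, H2⟩ := H h hh
    have hh0 := hh.1
    have s1 : μ.real (Ico (-h) 0) = μ.real (Ioc 0 h) := by
      rw [hμ, ← energyMeasure_real_neg t measurableSet_Ioc]; simp
    have s2 : μ.real (Ioc (-h) 0) = μ.real (Ico 0 h) := by
      rw [hμ, ← energyMeasure_real_neg t measurableSet_Ico]; simp
    have u1 : μ.real (Ioo (-h) h) ≤ μ.real (Ico (-h) 0) + μ.real {0} + μ.real (Ioc 0 h) := by
      refine (measureReal_mono ?_).trans
        ((measureReal_union_le _ _).trans (add_le_add (measureReal_union_le _ _) le_rfl))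
      intro x hx
      rcases lt_trichotomy x 0 with h | h | h
      · exact Or.inl (Or.inl ⟨hx.1.le, h⟩)
      · exact Or.inl (Or.inr h)
      · exact Or.inr ⟨h, hx.2.le⟩
    have u2 : μ.real (Ico (-h) 0) + μ.real (Ioc 0 h) ≤ μ.real (Icc (-h) h) := by
      rw [← measureReal_union _ measurableSet_Ioc]
      · refine measureReal_mono ?_
        rintro x (hx | hx)
        · exact ⟨hx.1, hx.2.le.trans hh0.le⟩
        · exact ⟨by linarith [hx.1], hx.2⟩
      · rw [Set.disjoint_left]
        intro x hx hx'
        exact lt_asymm hx.2 hx'.1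
    have u3 : μ.real (Ioo (-h) h) ≤ μ.real (Ioc (-h) 0) + μ.real (Ico 0 h) := by
      refine (measureReal_mono ?_).trans (measureReal_union_le _ _)
      intro x hx
      rcases le_total x 0 with h | h
      · exact Or.inl ⟨hx.1, h⟩
      · exact Or.inr ⟨h, hx.2⟩
    have u4 : μ.real (Ico 0 h) ≤ μ.real (Ioc 0 h) := by
      have : μ.real (Ico 0 h) ≤ μ.real {0} + μ.real (Ioc 0 h) := by
        refine (measureReal_mono ?_).trans (measureReal_union_le _ _)
        intro x hx
        rcases hx.1.eq_or_lt with h | h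
        · exact Or.inl h.symm
        · exact Or.inr ⟨h, hx.2.le⟩
      linarith
    have e : (2 * Real.pi) ^ 3 * (2 * fermiDensity t * h) = 2 * (N * h) := by rw [hN]; ring
    rw [e] at H1 H2
    have hC2 : 0 ≤ C * h ^ 2 := by positivity
    rw [abs_le, abs_le]
    refine ⟨⟨?_, ?_⟩, ?_, ?_⟩ <;> linarith
  have hIic : ∀ x y : ℝ, x ≤ y → μ.real (Iic y) = μ.real (Iic x) + μ.real (Ioc x y) := by
    intro x y hxy
    rw [← measureReal_union _ measurableSet_Ioc, Iic_union_Ioc_eq_Iic hxy]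
    rw [Set.disjoint_left]
    intro z hz hz'
    exact absurd hz'.1 (not_lt.2 hz)
  rw [hasDerivAt_iff_isLittleO]
  have hO : (fun x => integratedDOS t x - integratedDOS t 0 - (x - 0) • fermiDensity t)
      =O[nhds 0] fun x : ℝ => (x - 0) ^ 2 := by
    refine Asymptotics.IsBigO.of_bound (C / (2 * Real.pi) ^ 3) ?_
    filter_upwards [Ioo_mem_nhds (show (-1 : ℝ) < 0 by norm_num) one_pos] with x hx
    have e : integratedDOS t x - integratedDOS t 0 - (x - 0) • fermiDensity t =
        (μ.real (Iic x) - μ.real (Iic 0) - N * x) / (2 * Real.pi) ^ 3 := by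
      rw [integratedDOS_eq, integratedDOS_eq, hN, smul_eq_mul, sub_zero, ← hμ]
      field_simp
    rw [e, norm_div, Real.norm_eq_abs, Real.norm_eq_abs, Real.norm_eq_abs,
      abs_of_pos hpi, sub_zero, abs_of_nonneg (sq_nonneg x), div_mul_eq_mul_div]
    gcongr
    rcases lt_trichotomy x 0 with h | h | h
    · have := (hkey (-x) ⟨by linarith, by linarith [hx.1]⟩).2
      rw [neg_neg] at this
      rw [neg_sq] at this
      rw [hIic x 0 h.le, show μ.real (Iic x) - (μ.real (Iic x) + μ.real (Ioc x 0)) - N * x =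
        -(μ.real (Ioc x 0) - N * -x) by ring, abs_neg]
      exact this
    · simp [h]
    · have := (hkey x ⟨h, hx.2⟩).1
      rwa [hIic 0 x h.le, add_sub_cancel_left]
  refine hO.trans_isLittleO ?_
  simpa using (Asymptotics.isLittleO_pow_id (𝕜 := ℝ) (n := 2) (by norm_num))

theorem densityOfStates_zero {t : ℝ} (ht : t ∈ Ioo (0 : ℝ) 2) :
    densityOfStates t 0 = fermiDensity t := (hasDerivAt_integratedDOS ht).deriv

/-- A lower bound for the volume of a thin energy shell: in the box `|kᵢ - π/2| ≤ 1/8`, `i = 2, 3`,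
every line in the direction `k₁` meets it in a segment of length at least `h / 2`. -/
theorem le_energyMeasure_Ioc {t h : ℝ} (ht : t ∈ Ioo (0 : ℝ) 2) (hh : h ∈ Ioo (0 : ℝ) 1) :
    h / 32 ≤ (energyMeasure t).real (Ioc 0 h) := by
  have hpi := Real.pi_gt_three
  set J := Icc (Real.pi / 2 - 1 / 8) (Real.pi / 2 + 1 / 8) with hJ
  set S := band t ⁻¹' (Ioc 0 h) ∩ brillouinZone with hS
  have hSm : MeasurableSet S := ((measurable_band t) measurableSet_Ioc).inter
    measurableSet_brillouinZone
  have hcos : ∀ y ∈ J, |Real.cos y| ≤ 1 / 8 := by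
    intro y hy
    have := Real.abs_cos_sub_cos_le y (Real.pi / 2)
    rw [Real.cos_pi_div_two, sub_zero] at this
    refine this.trans ?_
    rw [abs_le]
    constructor <;> linarith [hy.1, hy.2]
  have hslice : ∀ p ∈ J ×ˢ J, ENNReal.ofReal (h / 2) ≤ volume ((fun x => (x, p)) ⁻¹' S) := by
    rintro ⟨y, z⟩ ⟨hy, hz⟩
    have c1 := abs_le.1 (hcos y hy)
    have c2 := hcos z hz
    have c3 : |t * Real.cos z| ≤ 1 / 4 := by
      rw [abs_mul, abs_of_pos ht.1]
      nlinarith [ht.1, ht.2, abs_nonneg (Real.cos z)]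
    rw [abs_le] at c3
    set v := Real.cos y + t * Real.cos z with hv
    set b := Real.arccos (-v) with hb
    have hcb : Real.cos b = -v := Real.cos_arccos (by linarith) (by linarith)
    have hb0 : 0 ≤ b := Real.arccos_nonneg _
    have hbpi : b + h / 2 ≤ Real.pi := by
      have h1 := Real.abs_cos_sub_cos_le b Real.pi
      rw [hcb, Real.cos_pi, abs_of_pos (by linarith),
        abs_of_nonpos (by linarith [Real.arccos_le_pi (-v)])] at h1
      linarith [hh.2]
    have hsub : Ioc b (b + h / 2) ⊆ (fun x => (x, (y, z))) ⁻¹' S := by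
      intro x hx
      have hx1 : Real.cos x < Real.cos b :=
        Real.cos_lt_cos_of_nonneg_of_le_pi hb0 (hx.2.trans hbpi) hx.1
      have hx2 := Real.abs_cos_sub_cos_le b x
      rw [abs_of_pos (by linarith), abs_of_neg (by linarith [hx.1])] at hx2
      have hband : band t (x, (y, z)) = -2 * (Real.cos x + v) := by
        simp only [band, hv]; ring
      refine ⟨?_, ⟨by linarith [hx.1], hx.2.trans hbpi⟩,
        ⟨by linarith [hy.1], by linarith [hy.2]⟩, by linarith [hz.1], by linarith [hz.2]⟩
      simp only [mem_preimage, hband, mem_Ioc]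
      constructor <;> linarith [hx.2]
    refine le_trans ?_ (measure_mono hsub)
    rw [Real.volume_Ioc]
    exact ENNReal.ofReal_le_ofReal (by linarith)
  have hvol : ENNReal.ofReal (h / 32) ≤ volume S := by
    rw [Measure.volume_eq_prod, Measure.prod_apply_symm hSm]
    calc ENNReal.ofReal (h / 32) = ENNReal.ofReal (h / 2) * volume (J ×ˢ J) := by
          rw [Measure.volume_eq_prod, Measure.prod_prod, hJ, Real.volume_Icc,
            ← ENNReal.ofReal_mul (by linarith), ← ENNReal.ofReal_mul (by linarith [hh.1])]
          congr 1
          ring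
      _ = ∫⁻ _ in J ×ˢ J, ENNReal.ofReal (h / 2) := (setLIntegral_const _ _).symm
      _ ≤ ∫⁻ p in J ×ˢ J, volume ((fun x => (x, p)) ⁻¹' S) :=
          setLIntegral_mono' (measurableSet_Icc.prod measurableSet_Icc) hslice
      _ ≤ _ := setLIntegral_le_lintegral _ _
  rw [energyMeasure, map_measureReal_apply (measurable_band t) measurableSet_Ioc, Measure.real,
    Measure.restrict_apply ((measurable_band t) measurableSet_Ioc)]
  refine (ENNReal.ofReal_le_iff_le_toReal ?_).1 hvol
  exact ((measure_mono inter_subset_right).trans_lt isCompact_brillouinZone.measure_lt_top).ne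

theorem le_fermiDensity {t : ℝ} (ht : t ∈ Ioo (0 : ℝ) 2) :
    1 / (32 * (2 * Real.pi) ^ 3) ≤ fermiDensity t := by
  have hpi : 0 < (2 * Real.pi) ^ 3 := by have := Real.pi_pos; positivity
  refine ge_of_tendsto (hasDerivAt_integratedDOS ht).tendsto_slope_zero_right ?_
  filter_upwards [Ioo_mem_nhdsGT (one_pos (α := ℝ))] with h hh
  have h1 := le_energyMeasure_Ioc ht hh
  have h2 : (energyMeasure t).real (Iic h) =
      (energyMeasure t).real (Iic 0) + (energyMeasure t).real (Ioc 0 h) := by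
    rw [← measureReal_union _ measurableSet_Ioc, Iic_union_Ioc_eq_Iic hh.1.le]
    rw [Set.disjoint_left]
    intro z hz hz'
    exact absurd hz'.1 (not_lt.2 hz)
  have hh0 := hh.1
  rw [zero_add, integratedDOS_eq, integratedDOS_eq, h2, smul_eq_mul, ← sub_div, add_sub_cancel_left,
    ← div_div, inv_mul_eq_div, div_div, div_div, div_le_div_iff₀ (by positivity) (by positivity)]
  nlinarith

theorem fermiDensity_pos {t : ℝ} (ht : t ∈ Ioo (0 : ℝ) 2) : 0 < fermiDensity t :=
  lt_of_lt_of_le (by have := Real.pi_pos; positivity) (le_fermiDensity ht)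

/-! ### The BCS gap function -/

/-- The integrand of the BCS gap equation, written with the continuous gap kernel. -/
noncomputable def bcsKernel (x y e : ℝ) : ℝ :=
  gapKernel y (Real.sqrt (x ^ 2 + e ^ 2)) - gapKernel 1 e

/-- The function `J(x, y)` whose zero in `x` is the BCS gap. -/
noncomputable def bcsIntegral (x y : ℝ) : ℝ := ∫ e in Ioi 0, bcsKernel x y e

theorem sqrt_pos_of_pos_right (x : ℝ) {e : ℝ} (he : 0 < e) : 0 < Real.sqrt (x ^ 2 + e ^ 2) :=
  Real.sqrt_pos.2 (by positivity)

theorem le_sqrt_right (x e : ℝ) : e ≤ Real.sqrt (x ^ 2 + e ^ 2) :=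
  Real.le_sqrt_of_sq_le (by nlinarith [sq_nonneg x])

theorem le_sqrt_left (x e : ℝ) : x ≤ Real.sqrt (x ^ 2 + e ^ 2) :=
  Real.le_sqrt_of_sq_le (by nlinarith [sq_nonneg e])

theorem bcsIntegrand_eq (x y : ℝ) {e : ℝ} (he : 0 < e) : bcsIntegrand x y e = bcsKernel x y e := by
  have h := tanh_div one_pos he.ne'
  rw [mul_one] at h
  rw [bcsIntegrand, bcsKernel, thermalTanh_div (sqrt_pos_of_pos_right x he).ne', h]

theorem isBCSGap_iff {x y : ℝ} :
    IsBCSGap x y ↔ 0 ≤ x ∧ IntegrableOn (bcsKernel x y) (Ioi 0) ∧ bcsIntegral x y = 0 := by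
  have h : EqOn (bcsIntegrand x y) (bcsKernel x y) (Ioi 0) := fun e he => bcsIntegrand_eq x y he
  rw [IsBCSGap, integrableOn_congr_fun h measurableSet_Ioi,
    setIntegral_congr_fun measurableSet_Ioi h]
  rfl

theorem measurable_bcsKernel (x y : ℝ) : Measurable (bcsKernel x y) := by
  unfold bcsKernel
  exact ((measurable_gapKernel y).comp (by fun_prop)).sub (measurable_gapKernel 1)

/-- The leading terms `1 / e` cancel, so that the BCS integrand has cubic decay. -/
theorem abs_bcsKernel_le {x y A R : ℝ} (hy : y ∈ Icc (0 : ℝ) 1) (hxR : x ^ 2 ≤ R) (hA : 1 / 2 ≤ A)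
    {e : ℝ} (he : 0 < e) (hρ : gapKernel y (Real.sqrt (x ^ 2 + e ^ 2)) ≤ A) :
    |bcsKernel x y e| ≤ 8 * (A + 8 + R) / (1 + e) ^ 3 := by
  have hR : 0 ≤ R := (sq_nonneg x).trans hxR
  have hs := sqrt_pos_of_pos_right x he
  have hes := le_sqrt_right x e
  have hsq : Real.sqrt (x ^ 2 + e ^ 2) ^ 2 = x ^ 2 + e ^ 2 := Real.sq_sqrt (by positivity)
  have hp := gapKernel_pos hy.1 hs
  rw [bcsKernel]
  set ρ := Real.sqrt (x ^ 2 + e ^ 2)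
  rcases le_total e 1 with h | h
  · have h1 := gapKernel_pos_of_pos one_pos e
    have h2 := gapKernel_le one_pos e
    have h3 : |gapKernel y ρ - gapKernel 1 e| ≤ A := by
      rw [abs_le]; constructor <;> linarith
    refine h3.trans ?_
    rw [le_div_iff₀ (by positivity)]
    have h4 : (1 + e) ^ 3 ≤ 2 ^ 3 := by gcongr; linarith
    nlinarith
  · have h1 := abs_gapKernel_sub_inv_le hy.1 hy.2 hs
    have h2 := abs_gapKernel_sub_inv_le zero_le_one le_rfl he
    have hexp : Real.exp (-e) ≤ 2 / e ^ 2 := by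
      rw [Real.exp_neg, inv_le_comm₀ (Real.exp_pos e) (by positivity), inv_div]
      have := Real.quadratic_le_exp_of_nonneg he.le
      linarith
    have h3 : 2 * Real.exp (-ρ) / ρ ≤ 4 / e ^ 3 := by
      calc 2 * Real.exp (-ρ) / ρ ≤ 2 * (2 / e ^ 2) / e := by
            gcongr
            exact (Real.exp_le_exp.2 (neg_le_neg hes)).trans hexp
        _ = _ := by field_simp; norm_num
    have h4 : 2 * Real.exp (-e) / e ≤ 4 / e ^ 3 := by
      calc 2 * Real.exp (-e) / e ≤ 2 * (2 / e ^ 2) / e := by gcongr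
        _ = _ := by field_simp; norm_num
    have h5 : |1 / ρ - 1 / e| ≤ R / e ^ 3 := by
      have e1 : 1 / e - 1 / ρ = x ^ 2 / (e * ρ * (ρ + e)) := by
        field_simp
        nlinarith
      rw [abs_sub_comm, e1, abs_of_nonneg (by positivity)]
      have : e ^ 3 ≤ e * ρ * (ρ + e) := by
        calc e ^ 3 = e * e * (0 + e) := by ring
          _ ≤ _ := by gcongr
      gcongr
    have h6 : |gapKernel y ρ - gapKernel 1 e| ≤ (8 + R) / e ^ 3 := by
      have e2 : gapKernel y ρ - gapKernel 1 e =
        (gapKernel y ρ - 1 / ρ) + (1 / ρ - 1 / e) - (gapKernel 1 e - 1 / e) := by ring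
      rw [e2]
      refine (abs_sub _ _).trans ((add_le_add (abs_add_le _ _) le_rfl).trans ?_)
      have : (8 + R) / e ^ 3 = 4 / e ^ 3 + R / e ^ 3 + 4 / e ^ 3 := by ring
      linarith
    refine h6.trans ?_
    rw [div_le_div_iff₀ (by positivity) (by positivity)]
    have h7 : (1 + e) ^ 3 ≤ (2 * e) ^ 3 := by gcongr; linarith
    have h8 : 0 < e ^ 3 := by positivity
    nlinarith [mul_pos (show 0 < A by linarith) h8]

theorem integrableOn_inv_one_add_pow_three {X : ℝ} (hX : 0 ≤ X) :
    IntegrableOn (fun e : ℝ => 1 / (1 + e) ^ 3) (Ioi X) ∧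
      ∫ e in Ioi X, 1 / (1 + e) ^ 3 = 1 / (2 * (1 + X) ^ 2) := by
  have hd : ∀ e ∈ Ici X,
      HasDerivAt (fun e : ℝ => -(1 / (2 * (1 + e) ^ 2))) (1 / (1 + e) ^ 3) e := by
    intro e he
    have h0 : 0 < 1 + e := by have : X ≤ e := he; linarith
    have h1 : HasDerivAt (fun e : ℝ => 2 * (1 + e) ^ 2) (4 * (1 + e)) e :=
      ((((hasDerivAt_id e).const_add 1).pow 2).const_mul 2).congr_deriv (by simp; ring)
    have h2 := (h1.inv (by positivity)).neg
    simp only [one_div]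
    refine h2.congr_deriv ?_
    field_simp
    ring
  have hpos : ∀ e ∈ Ioi X, 0 ≤ 1 / (1 + e) ^ 3 := by
    intro e he
    have h0 : 0 < 1 + e := by have : X < e := he; linarith
    positivity
  have hlim : Filter.Tendsto (fun e : ℝ => -(1 / (2 * (1 + e) ^ 2))) Filter.atTop (nhds 0) := by
    rw [← neg_zero]
    refine Filter.Tendsto.neg (Filter.Tendsto.div_atTop tendsto_const_nhds ?_)
    refine Filter.Tendsto.const_mul_atTop two_pos ?_
    exact (Filter.tendsto_pow_atTop two_ne_zero).comp
      (Filter.tendsto_atTop_add_const_left _ _ Filter.tendsto_id)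
  refine ⟨integrableOn_Ioi_deriv_of_nonneg' hd hpos hlim, ?_⟩
  rw [integral_Ioi_of_hasDerivAt_of_nonneg' hd hpos hlim]
  ring

/-- A bound for the gap kernel that is uniform as long as `x` or `y` stays away from `0`. -/
theorem gapKernel_sqrt_le_max {a b x y : ℝ} (hb : 0 ≤ b) (hab : 0 < a ∨ 0 < b)
    (hx : a ≤ x) (hy : b ≤ y) {e : ℝ} (he : 0 < e) :
    gapKernel y (Real.sqrt (x ^ 2 + e ^ 2)) ≤ 1 / 2 + max (1 / a) (1 / (2 * b)) := by
  have hs := sqrt_pos_of_pos_right x he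
  rcases hab with h | h
  · refine (gapKernel_le_inv hs).trans ?_
    have : 1 / Real.sqrt (x ^ 2 + e ^ 2) ≤ 1 / a := by
      gcongr
      exact hx.trans (le_sqrt_left x e)
    linarith [le_max_left (1 / a) (1 / (2 * b))]
  · refine (gapKernel_antitone_left hb hy hs).trans ((gapKernel_le h _).trans ?_)
    linarith [le_max_right (1 / a) (1 / (2 * b))]

/-- An integrable majorant of the BCS integrand for `x ∈ [a, R]`, `y ∈ [b, 1]`. -/
theorem exists_abs_bcsKernel_le {a b : ℝ} (ha : 0 ≤ a) (hb : 0 ≤ b) (hab : 0 < a ∨ 0 < b) (R : ℝ) :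
    ∃ C : ℝ, 0 < C ∧ ∀ x ∈ Icc a R, ∀ y ∈ Icc b 1, ∀ e : ℝ, 0 < e →
      |bcsKernel x y e| ≤ C / (1 + e) ^ 3 := by
  have hmax : 0 ≤ max (1 / a) (1 / (2 * b)) := le_max_of_le_left (by positivity)
  refine ⟨8 * (1 / 2 + max (1 / a) (1 / (2 * b)) + 8 + R ^ 2), by positivity, ?_⟩
  intro x hx y hy e he
  have hx0 := ha.trans hx.1
  exact abs_bcsKernel_le ⟨hb.trans hy.1, hy.2⟩ (pow_le_pow_left₀ hx0 hx.2 2) (by linarith) he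
    (gapKernel_sqrt_le_max hb hab hx.1 hy.1 he)

theorem integrableOn_bcsKernel {x y : ℝ} (hx : 0 ≤ x) (hy : y ∈ Icc (0 : ℝ) 1)
    (hxy : 0 < x ∨ 0 < y) : IntegrableOn (bcsKernel x y) (Ioi 0) := by
  obtain ⟨C, -, hC⟩ := exists_abs_bcsKernel_le hx hy.1 hxy x
  refine Integrable.mono' ((integrableOn_inv_one_add_pow_three le_rfl).1.const_mul C)
    (measurable_bcsKernel x y).aestronglyMeasurable ?_
  refine (ae_restrict_mem measurableSet_Ioi).mono fun e he => ?_
  rw [Real.norm_eq_abs, mul_one_div]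
  exact hC x ⟨le_rfl, le_rfl⟩ y ⟨le_rfl, hy.2⟩ e he

/-- Quantitative monotonicity of `J` in the gap, uniform in the temperature. -/
theorem exists_bcsIntegral_sub_ge (R : ℝ) : ∃ c : ℝ, 0 < c ∧ ∀ y ∈ Icc (0 : ℝ) 1, ∀ x x' : ℝ,
    0 ≤ x → x ≤ x' → x' ≤ R → IntegrableOn (bcsKernel x y) (Ioi 0) →
    IntegrableOn (bcsKernel x' y) (Ioi 0) →
      c * (x' ^ 2 - x ^ 2) ≤ bcsIntegral x y - bcsIntegral x' y := by
  obtain ⟨c, hc, H⟩ := exists_gapKernel_sub_ge (R + 1)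
  refine ⟨c, hc, fun y hy x x' hx hxx' hR hI hI' => ?_⟩
  have hle : ∀ e : ℝ, x ^ 2 + e ^ 2 ≤ x' ^ 2 + e ^ 2 := fun e => by gcongr
  rw [bcsIntegral, bcsIntegral, ← integral_sub hI hI']
  have hD : ∀ e ∈ Ioi (0 : ℝ), 0 ≤ bcsKernel x y e - bcsKernel x' y e := by
    intro e he
    have := (gapKernel_strictAntiOn hy.1).antitoneOn (sqrt_pos_of_pos_right x he)
      (sqrt_pos_of_pos_right x' he) (Real.sqrt_le_sqrt (hle e))
    simp only [bcsKernel]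
    linarith
  have hD1 : ∀ e ∈ Ioc (0 : ℝ) 1, c * (x' ^ 2 - x ^ 2) ≤ bcsKernel x y e - bcsKernel x' y e := by
    intro e he
    have h1 := H y hy _ _ (sqrt_pos_of_pos_right x he.1) (Real.sqrt_le_sqrt (hle e)) (by
      rw [Real.sqrt_le_left (by linarith)]
      nlinarith [he.1, he.2])
    rw [Real.sq_sqrt (by positivity), Real.sq_sqrt (by positivity)] at h1
    simp only [bcsKernel]
    linarith
  calc c * (x' ^ 2 - x ^ 2) = ∫ e in Ioc (0 : ℝ) 1, c * (x' ^ 2 - x ^ 2) := by simp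
    _ ≤ ∫ e in Ioc (0 : ℝ) 1, (bcsKernel x y e - bcsKernel x' y e) :=
        setIntegral_mono_on (integrableOn_const measure_Ioc_lt_top.ne)
          ((hI.sub hI').mono_set Ioc_subset_Ioi_self)
          measurableSet_Ioc hD1
    _ ≤ _ := setIntegral_mono_set (hI.sub hI')
        ((ae_restrict_mem measurableSet_Ioi).mono hD) Ioc_subset_Ioi_self.eventuallyLE

theorem bcsIntegral_antitone_right {x y y' : ℝ} (hx : 0 < x) (hy : 0 ≤ y) (hyy' : y ≤ y')
    (hy' : y' ≤ 1) : bcsIntegral x y' ≤ bcsIntegral x y := by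
  refine setIntegral_mono_on (integrableOn_bcsKernel hx.le ⟨hy.trans hyy', hy'⟩ (Or.inl hx))
    (integrableOn_bcsKernel hx.le ⟨hy, hyy'.trans hy'⟩ (Or.inl hx)) measurableSet_Ioi ?_
  intro e he
  exact sub_le_sub_right (gapKernel_antitone_left hy hyy' (sqrt_pos_of_pos_right x he)) _

/-- The integrand is nonpositive at every energy if `x = 2`, which bounds the BCS gap by `2`. -/
theorem bcsIntegral_two_nonpos (y : ℝ) : bcsIntegral 2 y ≤ 0 := by
  refine setIntegral_nonpos measurableSet_Ioi fun e he => ?_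
  have := gapKernel_sqrt_le one_pos he y
  rw [mul_one] at this
  exact sub_nonpos.2 this

theorem bcsKernel_zero_left (y : ℝ) {e : ℝ} (he : 0 < e) :
    bcsKernel 0 y e = gapKernel y e - gapKernel 1 e := by
  rw [bcsKernel, zero_pow two_ne_zero, zero_add, Real.sqrt_sq he.le]

theorem bcsIntegral_zero_one : bcsIntegral 0 1 = 0 :=
  setIntegral_eq_zero_of_forall_eq_zero fun e he => by rw [bcsKernel_zero_left 1 he, sub_self]

theorem bcsIntegral_zero_pos {y : ℝ} (hy : y ∈ Ioo (0 : ℝ) 1) : 0 < bcsIntegral 0 y := by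
  have hpos : ∀ e ∈ Ioi (0 : ℝ), 0 < bcsKernel 0 y e := fun e he => by
    rw [bcsKernel_zero_left y he]
    exact sub_pos.2 (gapKernel_strictAnti_left hy.1 hy.2 he)
  refine (setIntegral_pos_iff_support_of_nonneg_ae
    ((ae_restrict_mem measurableSet_Ioi).mono fun e he => (hpos e he).le)
    (integrableOn_bcsKernel le_rfl ⟨hy.1.le, hy.2.le⟩ (Or.inr hy.1))).2 ?_
  have : Function.support (bcsKernel 0 y) ∩ Ioi 0 = Ioi 0 :=
    inter_eq_right.2 fun e he => (hpos e he).ne'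
  rw [this]
  simp

theorem continuousOn_bcsIntegral {a y : ℝ} (ha : 0 ≤ a) (hy : y ∈ Icc (0 : ℝ) 1)
    (hay : 0 < a ∨ 0 < y) (R : ℝ) : ContinuousOn (fun x => bcsIntegral x y) (Icc a R) := by
  obtain ⟨C, -, hC⟩ := exists_abs_bcsKernel_le ha hy.1 hay R
  refine continuousOn_of_dominated (bound := fun e => C * (1 / (1 + e) ^ 3))
    (fun x _ => (measurable_bcsKernel x y).aestronglyMeasurable) ?_
    ((integrableOn_inv_one_add_pow_three le_rfl).1.const_mul C) ?_
  · intro x hx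
    refine (ae_restrict_mem measurableSet_Ioi).mono fun e he => ?_
    rw [Real.norm_eq_abs, mul_one_div]
    exact hC x hx y ⟨le_rfl, hy.2⟩ e he
  · refine (ae_restrict_mem measurableSet_Ioi).mono fun e he => ?_
    unfold bcsKernel
    refine ContinuousOn.sub ?_ continuousOn_const
    exact (continuousOn_gapKernel hy.1).comp (by fun_prop) fun x _ => sqrt_pos_of_pos_right x he

/-- For `y < 1` the equation `J(x, y) = 0` has a positive solution. The integral `J(0, 0)` diverges,
so for `y = 0` the intermediate value theorem starts from the solution at `y = 1/2`. -/
theorem exists_bcsIntegral_eq_zero {y : ℝ} (hy : y ∈ Ico (0 : ℝ) 1) :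
    ∃ x : ℝ, 0 < x ∧ bcsIntegral x y = 0 := by
  have hpos : ∀ y ∈ Ioo (0 : ℝ) 1, ∃ x : ℝ, 0 < x ∧ x ≤ 2 ∧ bcsIntegral x y = 0 := by
    intro y hy
    have h0 := bcsIntegral_zero_pos hy
    obtain ⟨x, hx, hx0⟩ := intermediate_value_Icc' two_pos.le
      (continuousOn_bcsIntegral le_rfl ⟨hy.1.le, hy.2.le⟩ (Or.inr hy.1) 2)
      ⟨bcsIntegral_two_nonpos y, h0.le⟩
    refine ⟨x, hx.1.lt_of_ne ?_, hx.2, hx0⟩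
    rintro rfl
    exact h0.ne' hx0
  rcases hy.1.eq_or_lt with rfl | h
  · obtain ⟨x₀, h1, h2, h3⟩ := hpos (1 / 2) (by norm_num)
    obtain ⟨x, hx, hx0⟩ := intermediate_value_Icc' h2
      (continuousOn_bcsIntegral h1.le ⟨hy.1, hy.2.le⟩ (Or.inl h1) 2)
      ⟨bcsIntegral_two_nonpos 0, by
        have := bcsIntegral_antitone_right h1 le_rfl (by norm_num : (0 : ℝ) ≤ 1 / 2) (by norm_num)
        rwa [h3] at this⟩
    exact ⟨x, h1.trans_le hx.1, hx0⟩
  · obtain ⟨x, h1, -, h3⟩ := hpos y ⟨h, hy.2⟩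
    exact ⟨x, h1, h3⟩

theorem existsUnique_isBCSGap {y : ℝ} (hy : y ∈ Icc (0 : ℝ) 1) : ∃! x : ℝ, IsBCSGap x y := by
  have hex : ∃ x, IsBCSGap x y := by
    rcases hy.2.eq_or_lt with rfl | h
    · exact ⟨0, isBCSGap_iff.2 ⟨le_rfl, integrableOn_bcsKernel le_rfl hy (Or.inr one_pos),
        bcsIntegral_zero_one⟩⟩
    · obtain ⟨x, hx, h0⟩ := exists_bcsIntegral_eq_zero ⟨hy.1, h⟩
      exact ⟨x, isBCSGap_iff.2 ⟨hx.le, integrableOn_bcsKernel hx.le hy (Or.inl hx), h0⟩⟩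
  obtain ⟨x, hx⟩ := hex
  refine ⟨x, hx, fun x' hx' => ?_⟩
  have key : ∀ u v : ℝ, IsBCSGap u y → IsBCSGap v y → v ≤ u := by
    intro u v hu hv
    rw [isBCSGap_iff] at hu hv
    by_contra! hlt
    obtain ⟨c, hc, H⟩ := exists_bcsIntegral_sub_ge v
    have h1 := H y hy u v hu.1 hlt.le le_rfl hu.2.1 hv.2.1
    rw [hu.2.2, hv.2.2, sub_zero] at h1
    have h2 : 0 < v ^ 2 - u ^ 2 := by nlinarith [hu.1]
    have := mul_pos hc h2
    linarith
  exact le_antisymm (key x x' hx hx') (key x' x hx' hx)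

theorem isBCSGap_fBCS {y : ℝ} (hy : y ∈ Icc (0 : ℝ) 1) : IsBCSGap (fBCS y) y :=
  Classical.epsilon_spec (existsUnique_isBCSGap hy).exists

theorem fBCS_pos {y : ℝ} (hy : y ∈ Ico (0 : ℝ) 1) : 0 < fBCS y := by
  have hy' : y ∈ Icc (0 : ℝ) 1 := ⟨hy.1, hy.2.le⟩
  obtain ⟨x, hx, h0⟩ := exists_bcsIntegral_eq_zero hy
  have h1 : IsBCSGap x y :=
    isBCSGap_iff.2 ⟨hx.le, integrableOn_bcsKernel hx.le hy' (Or.inl hx), h0⟩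
  rwa [(existsUnique_isBCSGap hy').unique (isBCSGap_fBCS hy') h1]

theorem bcsIntegral_fBCS {y : ℝ} (hy : y ∈ Icc (0 : ℝ) 1) : bcsIntegral (fBCS y) y = 0 :=
  (isBCSGap_iff.1 (isBCSGap_fBCS hy)).2.2

theorem fBCS_le_two {y : ℝ} (hy : y ∈ Ico (0 : ℝ) 1) : fBCS y ≤ 2 := by
  have hy' : y ∈ Icc (0 : ℝ) 1 := ⟨hy.1, hy.2.le⟩
  have hf := isBCSGap_iff.1 (isBCSGap_fBCS hy')
  by_contra! hlt
  obtain ⟨c, hc, H⟩ := exists_bcsIntegral_sub_ge (fBCS y)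
  have h1 := H y hy' 2 (fBCS y) two_pos.le hlt.le le_rfl
    (integrableOn_bcsKernel two_pos.le hy' (Or.inl two_pos)) hf.2.1
  rw [hf.2.2] at h1
  have h2 := bcsIntegral_two_nonpos y
  have h3 : 0 < fBCS y ^ 2 - 2 ^ 2 := by nlinarith
  have := mul_pos hc h3
  linarith

theorem fBCS_antitone {y y' : ℝ} (hy : 0 ≤ y) (h : y ≤ y') (hy' : y' < 1) : fBCS y' ≤ fBCS y := by
  have hyI : y ∈ Icc (0 : ℝ) 1 := ⟨hy, h.trans hy'.le⟩
  have hyI' : y' ∈ Icc (0 : ℝ) 1 := ⟨hy.trans h, hy'.le⟩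
  have hf := isBCSGap_iff.1 (isBCSGap_fBCS hyI)
  have hp := fBCS_pos ⟨hyI'.1, hy'⟩
  by_contra! hlt
  obtain ⟨c, hc, H⟩ := exists_bcsIntegral_sub_ge (fBCS y')
  have h1 := H y hyI (fBCS y) (fBCS y') hf.1 hlt.le le_rfl hf.2.1
    (integrableOn_bcsKernel hp.le hyI (Or.inl hp))
  have h2 := bcsIntegral_antitone_right hp hy h hy'.le
  rw [hf.2.2] at h1
  rw [bcsIntegral_fBCS hyI'] at h2
  have h3 : 0 < fBCS y' ^ 2 - fBCS y ^ 2 := by nlinarith [hf.1]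
  have := mul_pos hc h3
  linarith

/-! ### The Néel temperature and the order parameter -/

/-- The integral over the Brillouin zone in the equation for the Néel temperature, without the
prefactors. -/
noncomputable def neelIntegral (t T : ℝ) : ℝ := ∫ k in brillouinZone, gapKernel T (band t k)

/-- The integral over the Brillouin zone in the mean-field equation, without the prefactors. -/
noncomputable def meanFieldIntegral (t T Δ : ℝ) : ℝ :=
  ∫ k in brillouinZone, gapKernel T (Real.sqrt (Δ ^ 2 + band t k ^ 2))

theorem volume_real_brillouinZone : volume.real brillouinZone = (2 * Real.pi) ^ 3 := by
  have hpi := Real.pi_pos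
  have h : volume.real (Icc (-Real.pi) Real.pi) = 2 * Real.pi := by
    rw [Real.volume_real_Icc_of_le (by linarith)]; ring
  rw [brillouinZone, Measure.volume_eq_prod, measureReal_prod_prod, Measure.volume_eq_prod,
    measureReal_prod_prod, h]
  ring

theorem two_pi_pow_three_pos : 0 < (2 * Real.pi) ^ 3 := by
  have := Real.pi_pos
  positivity

theorem setIntegral_const_brillouinZone (c : ℝ) :
    ∫ _ in brillouinZone, c = (2 * Real.pi) ^ 3 * c := by
  rw [setIntegral_const, volume_real_brillouinZone, smul_eq_mul]

theorem setIntegral_brillouinZone_lt {f g : ℝ × ℝ × ℝ → ℝ} (hf : Continuous f) (hg : Continuous g)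
    (h : ∀ k, f k < g k) : ∫ k in brillouinZone, f k < ∫ k in brillouinZone, g k := by
  rw [← sub_pos, ← integral_sub (integrableOn_brillouinZone hg) (integrableOn_brillouinZone hf)]
  refine (setIntegral_pos_iff_support_of_nonneg_ae
    (Filter.Eventually.of_forall fun k => (sub_pos.2 (h k)).le)
    (integrableOn_brillouinZone (hg.sub hf))).2 ?_
  have : Function.support (fun k => g k - f k) ∩ brillouinZone = brillouinZone :=
    inter_eq_right.2 fun k _ => (sub_pos.2 (h k)).ne'
  rw [this]
  have h1 : 0 < volume.real brillouinZone := by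
    rw [volume_real_brillouinZone]; exact two_pi_pow_three_pos
  exact (ENNReal.toReal_pos_iff.1 h1).1

theorem setIntegral_brillouinZone_mono {f g : ℝ × ℝ × ℝ → ℝ} (hf : Continuous f)
    (hg : Continuous g) (h : ∀ k, f k ≤ g k) :
    ∫ k in brillouinZone, f k ≤ ∫ k in brillouinZone, g k :=
  setIntegral_mono (integrableOn_brillouinZone hf) (integrableOn_brillouinZone hg) h

theorem continuous_gapKernel_band {T : ℝ} (hT : 0 < T) (t : ℝ) :
    Continuous fun k => gapKernel T (band t k) :=
  (continuous_gapKernel hT).comp (continuous_band t)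

theorem continuous_gapKernel_sqrt {T Δ : ℝ} (hT : 0 ≤ T) (hΔ : 0 < Δ) :
    Continuous fun e => gapKernel T (Real.sqrt (Δ ^ 2 + e ^ 2)) :=
  (continuousOn_gapKernel hT).comp_continuous (by fun_prop)
    fun e => Real.sqrt_pos.2 (by positivity)

theorem continuous_gapKernel_sqrt_band {T Δ : ℝ} (hT : 0 ≤ T) (hΔ : 0 < Δ) (t : ℝ) :
    Continuous fun k => gapKernel T (Real.sqrt (Δ ^ 2 + band t k ^ 2)) :=
  (continuous_gapKernel_sqrt hT hΔ).comp (continuous_band t)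

theorem ae_band_ne_zero {t : ℝ} (ht : t ∈ Ioo (0 : ℝ) 2) :
    ∀ᵐ k ∂volume.restrict brillouinZone, band t k ≠ 0 := by
  have h := energyMeasure_real_singleton_zero ht
  rw [measureReal_eq_zero_iff, energyMeasure,
    Measure.map_apply (measurable_band t) (measurableSet_singleton 0)] at h
  exact measure_eq_zero_iff_ae_notMem.1 h

theorem isNeelTemperature_iff {U t T : ℝ} (ht : t ∈ Ioo (0 : ℝ) 2) (hU : 0 < U) :
    IsNeelTemperature U t T ↔ 0 < T ∧ neelIntegral t T = 2 * (2 * Real.pi) ^ 3 / U := by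
  refine and_congr_right fun hT => ?_
  have h : ∫ k in brillouinZone, U * Real.tanh (band t k / (2 * T)) / (2 * band t k) =
      U / 2 * neelIntegral t T := by
    rw [neelIntegral, ← integral_const_mul]
    refine integral_congr_ae ((ae_band_ne_zero ht).mono fun k hk => ?_)
    simp only
    rw [← tanh_div hT hk]
    field_simp
  have hV := two_pi_pow_three_pos
  rw [h, eq_div_iff hV.ne', one_mul, eq_div_iff hU.ne']
  constructor <;> intro h <;> linarith

theorem isMeanFieldSolution_iff {U t T Δ : ℝ} (hU : 0 < U) (hΔ : 0 < Δ) :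
    IsMeanFieldSolution U t T Δ ↔ meanFieldIntegral t T Δ = 2 * (2 * Real.pi) ^ 3 / U := by
  have h : ∫ k in brillouinZone, U * thermalTanh (Real.sqrt (Δ ^ 2 + band t k ^ 2)) T
        / (2 * Real.sqrt (Δ ^ 2 + band t k ^ 2)) = U / 2 * meanFieldIntegral t T Δ := by
    rw [meanFieldIntegral, ← integral_const_mul]
    congr 1
    funext k
    have hs : 0 < Real.sqrt (Δ ^ 2 + band t k ^ 2) := Real.sqrt_pos.2 (by positivity)
    rw [← thermalTanh_div hs.ne']
    field_simp
  have hV := two_pi_pow_three_pos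
  rw [IsMeanFieldSolution, h, eq_comm, mul_eq_left₀ hΔ.ne', div_eq_iff hV.ne', one_mul,
    eq_div_iff hU.ne']
  constructor <;> intro h <;> linarith

theorem neelIntegral_strictAnti {t T T' : ℝ} (hT : 0 < T) (h : T < T') :
    neelIntegral t T' < neelIntegral t T := by
  refine setIntegral_brillouinZone_lt (continuous_gapKernel_band (hT.trans h) t)
    (continuous_gapKernel_band hT t) fun k => ?_
  rcases (abs_nonneg (band t k)).eq_or_lt with h0 | h0
  · rw [abs_eq_zero.1 h0.symm, gapKernel_of_pos hT, gapKernel_of_pos (hT.trans h), zero_div,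
      zero_div, tanhc_zero]
    gcongr
  · rw [← gapKernel_abs hT, ← gapKernel_abs (hT.trans h)]
    exact gapKernel_strictAnti_left hT h h0

theorem neelIntegral_le (t : ℝ) {T : ℝ} (hT : 0 < T) :
    neelIntegral t T ≤ (2 * Real.pi) ^ 3 * (1 / (2 * T)) := by
  rw [← setIntegral_const_brillouinZone]
  exact setIntegral_brillouinZone_mono (continuous_gapKernel_band hT t) continuous_const
    fun k => gapKernel_le hT _

theorem continuousOn_neelIntegral (t : ℝ) : ContinuousOn (neelIntegral t) (Ioi 0) := by
  intro T₀ hT₀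
  have h0 : 0 < T₀ := hT₀
  refine ContinuousAt.continuousWithinAt ?_
  refine ContinuousOn.continuousAt (s := Ioi (T₀ / 2)) ?_ (Ioi_mem_nhds (by linarith))
  refine continuousOn_of_dominated (bound := fun _ => 1 / T₀)
    (fun T _ => ((measurable_gapKernel T).comp (measurable_band t)).aestronglyMeasurable) ?_
    (integrableOn_brillouinZone continuous_const) ?_
  · intro T hT
    have hT' : T₀ / 2 < T := hT
    have hT0 : 0 < T := by linarith
    refine Filter.Eventually.of_forall fun k => ?_
    rw [Real.norm_eq_abs, abs_of_pos (gapKernel_pos_of_pos hT0 _)]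
    refine (gapKernel_le hT0 _).trans ?_
    gcongr
    linarith
  · refine Filter.Eventually.of_forall fun k => ?_
    have hT0 : ∀ T ∈ Ioi (T₀ / 2), 0 < T := fun T hT => by
      have hT' : T₀ / 2 < T := hT
      linarith
    refine ContinuousOn.congr (f := fun T => tanhc (band t k / (2 * T)) / (2 * T)) ?_
      fun T hT => gapKernel_of_pos (hT0 T hT) _
    have h2 : ContinuousOn (fun T : ℝ => 2 * T) (Ioi (T₀ / 2)) := by fun_prop
    have h3 : ∀ T ∈ Ioi (T₀ / 2), 2 * T ≠ 0 := fun T hT => by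
      have := hT0 T hT
      positivity
    exact (continuous_tanhc.comp_continuousOn (continuousOn_const.div h2 h3)).div h2 h3

/-- The integral in the equation for the Néel temperature is governed by the density of states at
the Fermi level, up to a bounded error. -/
theorem exists_abs_neelIntegral_sub_le {K : Set ℝ} (hK : IsCompact K)
    (hK2 : K ⊆ Ioo (0 : ℝ) 2) : ∃ C : ℝ, 0 < C ∧ ∀ t ∈ K, ∀ T : ℝ, 0 < T →
      |neelIntegral t T -
        (2 * Real.pi) ^ 3 * (2 * fermiDensity t * ∫ s in (0:ℝ)..8, gapKernel T s)| ≤ C := by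
  obtain ⟨C, hC, H⟩ := exists_abs_integral_comp_band_sub_le hK hK2
  have hV := two_pi_pow_three_pos
  refine ⟨C * ((2 * Real.pi) ^ 3 * 16), by positivity, fun t ht T hT => ?_⟩
  have hc := continuous_gapKernel hT
  refine (H t ht (gapKernel T) hc fun e => ?_).trans ?_
  · rw [← gapKernel_abs hT, abs_neg, gapKernel_abs hT]
  gcongr
  rw [← setIntegral_const_brillouinZone]
  have hb := continuous_band t
  have hm := continuous_tailMoment hc t
  have hs1 : ∀ s : ℝ, 0 ≤ s → s * |gapKernel T s| ≤ 1 := by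
    intro s hs
    rw [abs_of_pos (gapKernel_pos_of_pos hT s)]
    rcases hs.eq_or_lt with rfl | h
    · simp
    · calc s * gapKernel T s ≤ s * (1 / s) := by gcongr; exact gapKernel_le_inv h
        _ = 1 := by field_simp
  refine setIntegral_brillouinZone_mono
    (by have := (hc.comp hb); simp only [Function.comp_def] at this; fun_prop)
    continuous_const fun k => ?_
  have h8 := abs_band_le (hK2 ht) k
  have h0 := abs_nonneg (band t k)
  have h1 : band t k ^ 2 * |gapKernel T (band t k)| ≤ 8 := by
    have := hs1 |band t k| h0
    rw [gapKernel_abs hT] at this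
    calc band t k ^ 2 * |gapKernel T (band t k)| =
        |band t k| * (|band t k| * |gapKernel T (band t k)|) := by rw [← sq_abs]; ring
      _ ≤ 8 * 1 := by gcongr
      _ = 8 := by norm_num
  have h2 : ∫ s in |band t k|..8, s * |gapKernel T s| ≤ 8 := by
    calc _ ≤ ∫ s in |band t k|..8, (1 : ℝ) := by
          refine intervalIntegral.integral_mono_on h8 ?_ (by simp) fun s hs => hs1 s (h0.trans hs.1)
          exact (by fun_prop : Continuous fun s => s * |gapKernel T s|).intervalIntegrable _ _
      _ ≤ 8 := by simp
  linarith

theorem integral_one_div_add {T : ℝ} (hT : 0 < T) :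
    ∫ s in (0:ℝ)..8, 1 / (T + s) = Real.log ((8 + T) / T) := by
  have h := intervalIntegral.integral_comp_add_left (a := 0) (b := 8) (fun s : ℝ => 1 / s) T
  rw [h, integral_one_div]
  · ring_nf
  · rw [uIcc_of_le (by linarith)]
    intro h0
    linarith [h0.1]

theorem le_integral_gapKernel {T : ℝ} (hT : 0 < T) :
    Real.log (4 / T) ≤ ∫ s in (0:ℝ)..8, gapKernel T s := by
  have h2 : (0 : ℝ) < 2 * T := by positivity
  calc Real.log (4 / T) ≤ Real.log ((8 + 2 * T) / (2 * T)) := by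
        refine Real.log_le_log (by positivity) ?_
        rw [div_le_div_iff₀ hT h2]
        nlinarith
    _ = ∫ s in (0:ℝ)..8, 1 / (2 * T + s) := (integral_one_div_add h2).symm
    _ ≤ _ := by
        refine intervalIntegral.integral_mono_on (by norm_num) ?_
          ((continuous_gapKernel hT).intervalIntegrable _ _) fun s hs => inv_le_gapKernel hT hs.1
        refine ContinuousOn.intervalIntegrable ?_
        rw [uIcc_of_le (by norm_num)]
        refine continuousOn_const.div (by fun_prop) fun s hs => ?_
        have := hs.1
        positivity

theorem integral_gapKernel_le {T : ℝ} (hT : 0 < T) :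
    ∫ s in (0:ℝ)..8, gapKernel T s ≤ Real.log ((8 + T) / T) + 2 := by
  have hi : ContinuousOn (fun s : ℝ => 1 / (T + s)) (uIcc 0 8) := by
    rw [uIcc_of_le (by norm_num)]
    refine continuousOn_const.div (by fun_prop) fun s hs => ?_
    have := hs.1
    positivity
  have hd : ∀ s ∈ uIcc (0:ℝ) 8, HasDerivAt (fun s : ℝ => -(2 * T) * (T + s)⁻¹)
      (2 * T * (1 / (T + s)) ^ 2) s := by
    intro s hs
    rw [uIcc_of_le (by norm_num)] at hs
    have h0 : 0 < T + s := by linarith [hs.1]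
    refine ((((hasDerivAt_id s).const_add T).inv h0.ne').const_mul (-(2 * T))).congr_deriv ?_
    simp only [id]
    field_simp
  have hi2 : ContinuousOn (fun s : ℝ => 2 * T * (1 / (T + s)) ^ 2) (uIcc 0 8) :=
    continuousOn_const.mul (hi.pow 2)
  have h2 : ∫ s in (0:ℝ)..8, 2 * T * (1 / (T + s)) ^ 2 ≤ 2 := by
    rw [intervalIntegral.integral_eq_sub_of_hasDerivAt hd hi2.intervalIntegrable]
    have : 0 ≤ 2 * T * (T + 8)⁻¹ := by positivity
    have e : -(2 * T) * (T + 0)⁻¹ = -2 := by field_simp; ring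
    rw [e]
    linarith
  rw [← integral_one_div_add hT]
  calc _ ≤ ∫ s in (0:ℝ)..8, (1 / (T + s) + 2 * T * (1 / (T + s)) ^ 2) := by
        refine intervalIntegral.integral_mono_on (by norm_num)
          ((continuous_gapKernel hT).intervalIntegrable _ _)
          (hi.intervalIntegrable.add hi2.intervalIntegrable) fun s hs => ?_
        have h0 := hs.1
        -- `gapKernel T s ≤ min (1 / (2T)) (1 / s)`
        rcases le_total s T with h | h
        · refine (gapKernel_le hT s).trans ?_
          have h1 : 1 / (2 * T) ≤ 1 / (T + s) := by gcongr; linarith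
          have h2 : 0 ≤ 2 * T * (1 / (T + s)) ^ 2 := by positivity
          linarith
        · have hs0 : 0 < s := hT.trans_le h
          refine (gapKernel_le_inv hs0).trans ?_
          have e : 1 / (T + s) + 2 * T * (1 / (T + s)) ^ 2 = (3 * T + s) / (T + s) ^ 2 := by
            field_simp
            ring
          rw [e, div_le_div_iff₀ hs0 (by positivity)]
          nlinarith
    _ = _ := intervalIntegral.integral_add hi.intervalIntegrable hi2.intervalIntegrable
    _ ≤ _ := by linarith

theorem existsUnique_isNeelTemperature {U t : ℝ} (ht : t ∈ Ioo (0 : ℝ) 2) (hU : 0 < U) :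
    ∃! T : ℝ, IsNeelTemperature U t T := by
  have hV := two_pi_pow_three_pos
  have hN := fermiDensity_pos ht
  obtain ⟨C, hC, H⟩ := exists_abs_neelIntegral_sub_le (K := {t}) isCompact_singleton
    (by simpa using ht)
  -- the temperature `T₁` at which the lower bound with `log (4 / T₁)` reaches the required value
  set X := (2 * (2 * Real.pi) ^ 3 / U + C) / ((2 * Real.pi) ^ 3 * (2 * fermiDensity t)) with hX
  set T₁ := 4 / Real.exp X with hT₁
  have hT₁0 : 0 < T₁ := by positivity
  have h1 : 2 * (2 * Real.pi) ^ 3 / U ≤ neelIntegral t T₁ := by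
    have h2 := (abs_le.1 (H t rfl T₁ hT₁0)).1
    have h3 := le_integral_gapKernel hT₁0
    have h4 : Real.log (4 / T₁) = X := by
      rw [hT₁, div_div_cancel₀ (by norm_num), Real.log_exp]
    rw [h4] at h3
    have h5 : (2 * Real.pi) ^ 3 * (2 * fermiDensity t * X) = 2 * (2 * Real.pi) ^ 3 / U + C := by
      rw [hX]; field_simp
    have h6 : (2 * Real.pi) ^ 3 * (2 * fermiDensity t * X) ≤
        (2 * Real.pi) ^ 3 * (2 * fermiDensity t * ∫ s in (0:ℝ)..8, gapKernel T₁ s) := by gcongr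
    linarith
  have h2 : neelIntegral t (T₁ + U) ≤ 2 * (2 * Real.pi) ^ 3 / U := by
    refine (neelIntegral_le t (by positivity)).trans ?_
    rw [mul_one_div, div_le_div_iff₀ (by positivity) hU]
    nlinarith [mul_pos hV hT₁0, mul_pos hV hU]
  obtain ⟨T, hT, hT0⟩ := intermediate_value_Icc' (by linarith : T₁ ≤ T₁ + U)
    ((continuousOn_neelIntegral t).mono fun T hT => hT₁0.trans_le hT.1) ⟨h2, h1⟩
  refine ⟨T, (isNeelTemperature_iff ht hU).2 ⟨hT₁0.trans_le hT.1, hT0⟩, fun T' hT' => ?_⟩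
  obtain ⟨h3, h4⟩ := (isNeelTemperature_iff ht hU).1 hT'
  rcases lt_trichotomy T' T with h | h | h
  · have := neelIntegral_strictAnti (t := t) h3 h
    linarith
  · exact h
  · have := neelIntegral_strictAnti (t := t) (hT₁0.trans_le hT.1) h
    linarith

theorem neelTemperature_spec {U t : ℝ} (ht : t ∈ Ioo (0 : ℝ) 2) (hU : 0 < U) :
    0 < neelTemperature U t ∧
      neelIntegral t (neelTemperature U t) = 2 * (2 * Real.pi) ^ 3 / U :=
  (isNeelTemperature_iff ht hU).1
    (Classical.epsilon_spec (existsUnique_isNeelTemperature ht hU).exists)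

theorem neelTemperature_le {U t : ℝ} (ht : t ∈ Ioo (0 : ℝ) 2) (hU : 0 < U) :
    neelTemperature U t ≤ U / 4 := by
  obtain ⟨h0, h1⟩ := neelTemperature_spec ht hU
  have h2 := neelIntegral_le t h0
  have hV := two_pi_pow_three_pos
  rw [h1, mul_one_div, div_le_div_iff₀ hU (by positivity)] at h2
  have h3 : (2 * Real.pi) ^ 3 * (4 * neelTemperature U t) ≤ (2 * Real.pi) ^ 3 * U := by linarith
  linarith [le_of_mul_le_mul_left h3 hV]

theorem meanFieldIntegral_strictAnti (t : ℝ) {T Δ Δ' : ℝ} (hT : 0 ≤ T) (hΔ : 0 < Δ) (h : Δ < Δ') :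
    meanFieldIntegral t T Δ' < meanFieldIntegral t T Δ := by
  refine setIntegral_brillouinZone_lt (continuous_gapKernel_sqrt_band hT (hΔ.trans h) t)
    (continuous_gapKernel_sqrt_band hT hΔ t) fun k => ?_
  have h1 : Δ ^ 2 < Δ' ^ 2 := by gcongr
  exact gapKernel_strictAntiOn hT (Real.sqrt_pos.2 (by positivity))
    (Real.sqrt_pos.2 (by have := hΔ.trans h; positivity))
    (Real.sqrt_lt_sqrt (by positivity) (by linarith))

theorem meanFieldIntegral_le (t : ℝ) {T Δ : ℝ} (hT : 0 ≤ T) (hΔ : 0 < Δ) :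
    meanFieldIntegral t T Δ ≤ (2 * Real.pi) ^ 3 * (1 / Δ) := by
  rw [← setIntegral_const_brillouinZone]
  refine setIntegral_brillouinZone_mono (continuous_gapKernel_sqrt_band hT hΔ t) continuous_const
    fun k => ?_
  have h1 := le_sqrt_left Δ (band t k)
  refine (gapKernel_le_inv (hΔ.trans_le h1)).trans ?_
  gcongr

theorem meanFieldIntegral_antitone_left (t : ℝ) {T T' Δ : ℝ} (hT : 0 ≤ T) (h : T ≤ T')
    (hΔ : 0 < Δ) : meanFieldIntegral t T' Δ ≤ meanFieldIntegral t T Δ :=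
  setIntegral_brillouinZone_mono (continuous_gapKernel_sqrt_band (hT.trans h) hΔ t)
    (continuous_gapKernel_sqrt_band hT hΔ t) fun k =>
      gapKernel_antitone_left hT h (Real.sqrt_pos.2 (by positivity))

theorem meanFieldIntegral_zero (t : ℝ) {T : ℝ} (hT : 0 < T) :
    meanFieldIntegral t T 0 = neelIntegral t T := by
  unfold meanFieldIntegral neelIntegral
  congr 1
  funext k
  rw [zero_pow two_ne_zero, zero_add, Real.sqrt_sq_eq_abs, gapKernel_abs hT]

theorem continuousOn_meanFieldIntegral (t : ℝ) {T a : ℝ} (hT : 0 ≤ T) (ha : 0 ≤ a)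
    (h : 0 < a ∨ 0 < T) : ContinuousOn (meanFieldIntegral t T) (Ici a) := by
  refine continuousOn_of_dominated (bound := fun _ => 1 / 2 + max (1 / a) (1 / (2 * T)))
    (fun Δ _ => ((measurable_gapKernel T).comp (by
      have := measurable_band t
      fun_prop)).aestronglyMeasurable) ?_ (integrableOn_brillouinZone continuous_const) ?_
  · intro Δ hΔ
    have hm : 0 ≤ max (1 / a) (1 / (2 * T)) := le_max_of_le_left (by positivity)
    refine Filter.Eventually.of_forall fun k => ?_
    rw [Real.norm_eq_abs]
    rcases h with h | h
    · have h1 : a ≤ Real.sqrt (Δ ^ 2 + band t k ^ 2) := le_trans hΔ (le_sqrt_left _ _)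
      rw [abs_of_pos (gapKernel_pos hT (h.trans_le h1))]
      refine (gapKernel_le_inv (h.trans_le h1)).trans ?_
      have : 1 / Real.sqrt (Δ ^ 2 + band t k ^ 2) ≤ 1 / a := by gcongr
      linarith [le_max_left (1 / a) (1 / (2 * T))]
    · rw [abs_of_pos (gapKernel_pos_of_pos h _)]
      linarith [le_max_right (1 / a) (1 / (2 * T)),
        gapKernel_le h (Real.sqrt (Δ ^ 2 + band t k ^ 2))]
  · refine Filter.Eventually.of_forall fun k => ?_
    rcases h with h | h
    · exact (continuousOn_gapKernel hT).comp (by fun_prop) fun Δ hΔ =>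
        (h.trans_le hΔ).trans_le (le_sqrt_left _ _)
    · exact ((continuous_gapKernel h).comp (by fun_prop)).continuousOn

/-- Below the Néel temperature the mean-field equation has a positive solution. As the integral
diverges at `T = Δ = 0`, the case `T = 0` is compared with half the Néel temperature. -/
theorem exists_meanFieldIntegral_eq {U t T : ℝ} (ht : t ∈ Ioo (0 : ℝ) 2) (hU : 0 < U)
    (hT : T ∈ Ico 0 (neelTemperature U t)) :
    ∃ Δ : ℝ, 0 < Δ ∧ meanFieldIntegral t T Δ = 2 * (2 * Real.pi) ^ 3 / U := by
  obtain ⟨hN0, hN⟩ := neelTemperature_spec ht hU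
  have hU2 : ∀ T : ℝ, 0 ≤ T → meanFieldIntegral t T (U / 2) ≤ 2 * (2 * Real.pi) ^ 3 / U := by
    intro T hT
    refine (meanFieldIntegral_le t hT (by positivity)).trans (le_of_eq ?_)
    field_simp
  have hpos : ∀ T ∈ Ioo 0 (neelTemperature U t), ∃ Δ : ℝ, 0 < Δ ∧ Δ ≤ U / 2 ∧
      meanFieldIntegral t T Δ = 2 * (2 * Real.pi) ^ 3 / U := by
    intro T hT
    have h0 : 2 * (2 * Real.pi) ^ 3 / U < meanFieldIntegral t T 0 := by
      rw [meanFieldIntegral_zero t hT.1, ← hN]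
      exact neelIntegral_strictAnti hT.1 hT.2
    obtain ⟨Δ, hΔ, h1⟩ := intermediate_value_Icc' (by positivity : 0 ≤ U / 2)
      ((continuousOn_meanFieldIntegral t hT.1.le le_rfl (Or.inr hT.1)).mono Icc_subset_Ici_self)
      ⟨hU2 T hT.1.le, h0.le⟩
    refine ⟨Δ, hΔ.1.lt_of_ne ?_, hΔ.2, h1⟩
    rintro rfl
    exact h0.ne' h1
  rcases hT.1.eq_or_lt with rfl | h
  · obtain ⟨Δ', h1, h2, h3⟩ := hpos (neelTemperature U t / 2) ⟨by linarith, by linarith⟩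
    obtain ⟨Δ, hΔ, h4⟩ := intermediate_value_Icc' h2
      ((continuousOn_meanFieldIntegral t le_rfl h1.le (Or.inl h1)).mono Icc_subset_Ici_self)
      ⟨hU2 0 le_rfl, by
        have := meanFieldIntegral_antitone_left t le_rfl
          (by linarith : 0 ≤ neelTemperature U t / 2) h1
        rwa [h3] at this⟩
    exact ⟨Δ, h1.trans_le hΔ.1, h4⟩
  · obtain ⟨Δ, h1, -, h3⟩ := hpos T ⟨h, hT.2⟩
    exact ⟨Δ, h1, h3⟩

theorem existsUnique_isMeanFieldSolution {U t T : ℝ} (ht : t ∈ Ioo (0 : ℝ) 2) (hU : 0 < U)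
    (hT : T ∈ Ico 0 (neelTemperature U t)) :
    ∃! Δ : ℝ, 0 < Δ ∧ IsMeanFieldSolution U t T Δ := by
  obtain ⟨Δ, hΔ, h⟩ := exists_meanFieldIntegral_eq ht hU hT
  refine ⟨Δ, ⟨hΔ, (isMeanFieldSolution_iff hU hΔ).2 h⟩, fun Δ' hΔ' => ?_⟩
  have h' := (isMeanFieldSolution_iff hU hΔ'.1).1 hΔ'.2
  rcases lt_trichotomy Δ' Δ with hlt | hlt | hlt
  · have := meanFieldIntegral_strictAnti t hT.1 hΔ'.1 hlt
    linarith
  · exact hlt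
  · have := meanFieldIntegral_strictAnti t hT.1 hΔ hlt
    linarith

theorem orderParameter_spec {U t T : ℝ} (ht : t ∈ Ioo (0 : ℝ) 2) (hU : 0 < U)
    (hT : T ∈ Ico 0 (neelTemperature U t)) :
    0 < orderParameter U t T ∧
      meanFieldIntegral t T (orderParameter U t T) = 2 * (2 * Real.pi) ^ 3 / U := by
  have hex := (existsUnique_isMeanFieldSolution ht hU hT).exists
  have h : 0 < orderParameter U t T ∧ IsMeanFieldSolution U t T (orderParameter U t T) := by
    rw [orderParameter, dif_pos hex]
    exact hex.choose_spec
  exact ⟨h.1, (isMeanFieldSolution_iff hU h.1).1 h.2⟩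

/-! ### Asymptotics of the gap ratio -/

/-- After rescaling energies by `τ`, the difference of the integrals in the mean-field equation and
in the equation for the Néel temperature is `2 N J(x, y)`, up to an error of the order
`τ² (1 + log (1 / τ))`, where the logarithm is expressed through the second of these integrals. -/
theorem exists_abs_meanFieldIntegral_sub_le {K : Set ℝ} (hK : IsCompact K)
    (hK2 : K ⊆ Ioo (0 : ℝ) 2) {a : ℝ} (ha : 0 < a) (R : ℝ) :
    ∃ C : ℝ, 0 < C ∧ ∀ t ∈ K, ∀ τ : ℝ, 0 < τ → ∀ x ∈ Icc a R, ∀ y ∈ Icc (0 : ℝ) 1,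
      |meanFieldIntegral t (τ * y) (τ * x) - neelIntegral t τ -
        (2 * Real.pi) ^ 3 * (2 * fermiDensity t * bcsIntegral x y)| ≤
          C * τ ^ 2 * (1 + neelIntegral t τ) := by
  obtain ⟨C₁, hC₁, H₁⟩ := exists_abs_integral_comp_band_sub_le hK hK2
  obtain ⟨C₂, hC₂, H₂⟩ := exists_abs_bcsKernel_le ha.le le_rfl (Or.inl ha) R
  obtain ⟨C₃, hC₃, H₃⟩ := exists_fermiDensity_le hK hK2
  have hV := two_pi_pow_three_pos
  refine ⟨C₁ * (4 * C₂) + (2 * Real.pi) ^ 3 * (2 * C₃ * C₂), by positivity, ?_⟩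
  intro t ht τ hτ x hx y hy
  have ht2 := hK2 ht
  have hx0 : 0 < x := ha.trans_le hx.1
  have hNp := fermiDensity_pos ht2
  have hτy : 0 ≤ τ * y := mul_nonneg hτ.le hy.1
  have hτx : 0 < τ * x := mul_pos hτ hx0
  set φ : ℝ → ℝ := fun e => gapKernel (τ * y) (Real.sqrt ((τ * x) ^ 2 + e ^ 2)) - gapKernel τ e
    with hφdef
  have hφc : Continuous φ :=
    (continuous_gapKernel_sqrt hτy hτx).sub (continuous_gapKernel hτ)
  have heven : ∀ e, φ (-e) = φ e := fun e => by
    simp only [hφdef, neg_sq]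
    rw [← gapKernel_abs hτ, abs_neg, gapKernel_abs hτ]
  have hb := continuous_band t
  -- `φ` is the rescaled BCS integrand
  have hφ : ∀ e, φ e = bcsKernel x y (e / τ) / τ := by
    intro e
    have e1 : Real.sqrt ((τ * x) ^ 2 + e ^ 2) = τ * Real.sqrt (x ^ 2 + (e / τ) ^ 2) := by
      rw [show (τ * x) ^ 2 + e ^ 2 = τ ^ 2 * (x ^ 2 + (e / τ) ^ 2) by field_simp,
        Real.sqrt_mul (by positivity), Real.sqrt_sq hτ.le]
    have e2 : gapKernel τ e = gapKernel 1 (e / τ) / τ := by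
      rw [← gapKernel_mul hτ, mul_one, mul_div_cancel₀ _ hτ.ne']
    simp only [hφdef]
    rw [e1, gapKernel_mul hτ, e2, bcsKernel, sub_div]
  have hφabs : ∀ e, 0 < e → |φ e| ≤ C₂ * τ ^ 2 / (τ + e) ^ 3 := by
    intro e he
    rw [hφ, abs_div, abs_of_pos hτ]
    have := H₂ x hx y hy (e / τ) (by positivity)
    calc |bcsKernel x y (e / τ)| / τ ≤ C₂ / (1 + e / τ) ^ 3 / τ := by gcongr
      _ = _ := by field_simp
  have hφe : ∀ e, |φ e| = |φ (|e|)| := fun e => by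
    rcases abs_choice e with h | h <;> rw [h]
    rw [heven]
  -- the pointwise bounds for the second moments
  have hpt : ∀ k, band t k ^ 2 * |φ (band t k)| + ∫ s in |band t k|..8, s * |φ s| ≤
      4 * C₂ * τ ^ 2 * gapKernel τ (band t k) := by
    intro k
    have h8 := abs_band_le ht2 k
    have h0 := abs_nonneg (band t k)
    rw [hφe, ← sq_abs, ← gapKernel_abs hτ]
    set b := |band t k|
    have hg : 1 / (τ + b) ≤ 2 * gapKernel τ b := by
      refine le_trans ?_ (mul_le_mul_of_nonneg_left (inv_le_gapKernel hτ h0) two_pos.le)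
      rw [mul_one_div, div_le_div_iff₀ (by positivity) (by positivity)]
      linarith
    have hst : ∀ s, 0 ≤ s → s * |φ s| ≤ C₂ * τ ^ 2 * (1 / (τ + s)) ^ 2 := by
      intro s hs
      rcases hs.eq_or_lt with rfl | h
      · rw [zero_mul]; positivity
      · calc s * |φ s| ≤ (τ + s) * (C₂ * τ ^ 2 / (τ + s) ^ 3) := by
              gcongr
              · linarith
              · exact hφabs s h
          _ = _ := by field_simp
    have h1 : b ^ 2 * |φ b| ≤ C₂ * τ ^ 2 * (1 / (τ + b)) := by
      calc b ^ 2 * |φ b| = b * (b * |φ b|) := by ring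
        _ ≤ (τ + b) * (C₂ * τ ^ 2 * (1 / (τ + b)) ^ 2) := by
            have := hst b h0
            gcongr
            linarith
        _ = _ := by field_simp
    have h2 : ∫ s in b..8, s * |φ s| ≤ C₂ * τ ^ 2 * (1 / (τ + b)) := by
      have hd : ∀ s ∈ uIcc b 8, HasDerivAt (fun s : ℝ => -(τ + s)⁻¹) ((1 / (τ + s)) ^ 2) s := by
        intro s hs
        rw [uIcc_of_le h8] at hs
        have h0 : 0 < τ + s := by linarith [hs.1]
        refine (((hasDerivAt_id s).const_add τ).inv h0.ne').neg.congr_deriv ?_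
        simp only [id]
        field_simp
      have hi : ContinuousOn (fun s : ℝ => (1 / (τ + s)) ^ 2) (uIcc b 8) := by
        rw [uIcc_of_le h8]
        refine (continuousOn_const.div (by fun_prop) fun s hs => ?_).pow 2
        have := h0.trans hs.1
        positivity
      calc _ ≤ ∫ s in b..8, C₂ * τ ^ 2 * (1 / (τ + s)) ^ 2 := by
            refine intervalIntegral.integral_mono_on h8 ?_
              (hi.intervalIntegrable.const_mul _) fun s hs => hst s (h0.trans hs.1)
            exact (by fun_prop : Continuous fun s => s * |φ s|).intervalIntegrable _ _
        _ = C₂ * τ ^ 2 * (-(τ + 8)⁻¹ - -(τ + b)⁻¹) := by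
            rw [intervalIntegral.integral_const_mul,
              intervalIntegral.integral_eq_sub_of_hasDerivAt hd hi.intervalIntegrable]
        _ ≤ _ := by
            gcongr
            have : 0 ≤ (τ + 8)⁻¹ := by positivity
            rw [one_div]
            linarith
    calc _ ≤ C₂ * τ ^ 2 * (2 * gapKernel τ b) + C₂ * τ ^ 2 * (2 * gapKernel τ b) :=
          add_le_add (h1.trans (by gcongr)) (h2.trans (by gcongr))
      _ = _ := by ring
  have hmain := H₁ t ht φ hφc heven
  have hE : ∫ k in brillouinZone, (band t k ^ 2 * |φ (band t k)| +
      ∫ s in |band t k|..8, s * |φ s|) ≤ 4 * C₂ * τ ^ 2 * neelIntegral t τ := by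
    rw [neelIntegral, ← integral_const_mul]
    have h1 := hφc.comp hb
    simp only [Function.comp_def] at h1
    have h2 := continuous_tailMoment hφc t
    have h3 := continuous_gapKernel_band hτ t
    exact setIntegral_brillouinZone_mono (by fun_prop) (by fun_prop) hpt
  have hint : ∫ k in brillouinZone, φ (band t k) =
      meanFieldIntegral t (τ * y) (τ * x) - neelIntegral t τ :=
    integral_sub (integrableOn_brillouinZone (continuous_gapKernel_sqrt_band hτy hτx t))
      (integrableOn_brillouinZone (continuous_gapKernel_band hτ t))
  rw [hint] at hmain
  -- extending the energy integral from `[0, 8]` to `[0, ∞)`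
  have hJ : |(∫ s in (0:ℝ)..8, φ s) - bcsIntegral x y| ≤ C₂ * τ ^ 2 := by
    have hI := integrableOn_bcsKernel hx0.le hy (Or.inl hx0)
    have h8τ : 0 ≤ 8 / τ := by positivity
    have e1 : ∫ s in (0:ℝ)..8, φ s = ∫ u in (0:ℝ)..(8 / τ), bcsKernel x y u := by
      simp only [hφ]
      rw [intervalIntegral.integral_div, intervalIntegral.integral_comp_div _ hτ.ne', zero_div,
        smul_eq_mul, mul_div_cancel_left₀ _ hτ.ne']
    have e2 : bcsIntegral x y = (∫ u in (0:ℝ)..(8 / τ), bcsKernel x y u) +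
        ∫ u in Ioi (8 / τ), bcsKernel x y u := by
      rw [bcsIntegral, intervalIntegral.integral_of_le h8τ, ← Ioc_union_Ioi_eq_Ioi h8τ,
        setIntegral_union (Ioc_disjoint_Ioi le_rfl) measurableSet_Ioi
          (hI.mono_set Ioc_subset_Ioi_self) (hI.mono_set (Ioi_subset_Ioi h8τ))]
    obtain ⟨i1, i2⟩ := integrableOn_inv_one_add_pow_three h8τ
    have h1 : |∫ u in Ioi (8 / τ), bcsKernel x y u| ≤
        ∫ u in Ioi (8 / τ), C₂ * (1 / (1 + u) ^ 3) := by
      refine abs_integral_le_integral_abs.trans (setIntegral_mono_on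
        (hI.mono_set (Ioi_subset_Ioi h8τ)).abs (i1.const_mul _) measurableSet_Ioi fun u hu => ?_)
      rw [mul_one_div]
      exact H₂ x hx y hy u (h8τ.trans_lt hu)
    rw [integral_const_mul, i2] at h1
    rw [e1, e2, sub_add_cancel_left, abs_neg]
    refine h1.trans ?_
    gcongr
    rw [div_le_iff₀ (by positivity)]
    have : τ ^ 2 * (2 * (1 + 8 / τ) ^ 2) = 2 * (τ + 8) ^ 2 := by field_simp
    rw [this]
    nlinarith
  have hneel : 0 ≤ neelIntegral t τ := integral_nonneg fun k => (gapKernel_pos_of_pos hτ _).le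
  have h5 : |(2 * Real.pi) ^ 3 * (2 * fermiDensity t * ∫ s in (0:ℝ)..8, φ s) -
      (2 * Real.pi) ^ 3 * (2 * fermiDensity t * bcsIntegral x y)| ≤
      (2 * Real.pi) ^ 3 * (2 * C₃ * (C₂ * τ ^ 2)) := by
    rw [← mul_sub, ← mul_sub, abs_mul, abs_mul, abs_of_pos hV, abs_of_pos (by positivity)]
    have := H₃ t ht
    gcongr
  have h6 := abs_sub_le (meanFieldIntegral t (τ * y) (τ * x) - neelIntegral t τ)
    ((2 * Real.pi) ^ 3 * (2 * fermiDensity t * ∫ s in (0:ℝ)..8, φ s))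
    ((2 * Real.pi) ^ 3 * (2 * fermiDensity t * bcsIntegral x y))
  have h7 : C₁ * ∫ k in brillouinZone, (band t k ^ 2 * |φ (band t k)| +
      ∫ s in |band t k|..8, s * |φ s|) ≤ C₁ * (4 * C₂ * τ ^ 2 * neelIntegral t τ) := by gcongr
  calc _ ≤ C₁ * (4 * C₂ * τ ^ 2 * neelIntegral t τ) +
        (2 * Real.pi) ^ 3 * (2 * C₃ * (C₂ * τ ^ 2)) := by linarith
    _ ≤ C₁ * (4 * C₂ * τ ^ 2 * (1 + neelIntegral t τ)) +
        (2 * Real.pi) ^ 3 * (2 * C₃ * (C₂ * τ ^ 2)) * (1 + neelIntegral t τ) := by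
        refine add_le_add ?_ (le_mul_of_one_le_right (by positivity) (by linarith))
        gcongr
        linarith
    _ = _ := by ring

/-- The Néel temperature is exponentially small in the interaction. -/
theorem exists_neelTemperature_le_exp {K : Set ℝ} (hK : IsCompact K) (hK2 : K ⊆ Ioo (0 : ℝ) 2) :
    ∃ C : ℝ, 0 < C ∧ ∀ t ∈ K, ∀ U ∈ Ioo (0 : ℝ) 1,
      neelTemperature U t ≤ C * Real.exp (-(1 / (fermiDensity t * U))) := by
  obtain ⟨C, hC, H⟩ := exists_abs_neelIntegral_sub_le hK hK2
  have hV := two_pi_pow_three_pos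
  refine ⟨Real.exp (Real.log 9 + 2 + 16 * C), Real.exp_pos _, fun t ht U hU => ?_⟩
  have hU0 := hU.1
  have ht2 := hK2 ht
  have hN := fermiDensity_pos ht2
  have hNV : 1 / 32 ≤ (2 * Real.pi) ^ 3 * fermiDensity t := by
    have := le_fermiDensity ht2
    rw [div_le_iff₀ (by positivity)] at this
    linarith
  obtain ⟨hτ, hτU⟩ := neelTemperature_spec ht2 hU0
  have hτ1 : neelTemperature U t ≤ 1 := by linarith [neelTemperature_le ht2 hU0, hU.2]
  set τ := neelTemperature U t
  have h1 := (abs_le.1 (H t ht τ hτ)).2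
  have h2 := integral_gapKernel_le hτ
  have h3 : Real.log ((8 + τ) / τ) ≤ Real.log 9 - Real.log τ := by
    rw [← Real.log_div (by norm_num) hτ.ne']
    refine Real.log_le_log (by positivity) ?_
    gcongr
    linarith
  set N := fermiDensity t
  set V := (2 * Real.pi) ^ 3
  have h4 : V * (2 * N * ∫ s in (0:ℝ)..8, gapKernel τ s) ≤
      V * (2 * N * (Real.log 9 - Real.log τ + 2)) := by gcongr; linarith
  have h5 : C ≤ V * (2 * N * (16 * C)) := by nlinarith
  have h6 : V * (2 * N) * (1 / (N * U)) ≤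
      V * (2 * N) * (Real.log 9 - Real.log τ + 2 + 16 * C) := by
    have e : V * (2 * N) * (1 / (N * U)) = 2 * V / U := by field_simp
    rw [e, ← hτU]
    linarith
  have h7 := le_of_mul_le_mul_left h6 (by positivity)
  rw [← Real.exp_add, ← Real.log_le_iff_le_exp hτ]
  linarith

/-- As the integral in the mean-field equation decreases in the gap, bracketing the equation
brackets the gap. -/
theorem abs_gapRatio_sub_le_of_bracket {U t T f η : ℝ} (ht : t ∈ Ioo (0 : ℝ) 2) (hU : 0 < U)
    (hT : T ∈ Ico 0 (neelTemperature U t)) (hfη : 0 < f - η) (hη : 0 ≤ η)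
    (hlow : 2 * (2 * Real.pi) ^ 3 / U ≤ meanFieldIntegral t T (neelTemperature U t * (f - η)))
    (hup : meanFieldIntegral t T (neelTemperature U t * (f + η)) ≤ 2 * (2 * Real.pi) ^ 3 / U) :
    |gapRatio U t T - f| ≤ η := by
  obtain ⟨hτ, -⟩ := neelTemperature_spec ht hU
  obtain ⟨hΔ, hΔU⟩ := orderParameter_spec ht hU hT
  rw [gapRatio]
  have hleft : neelTemperature U t * (f - η) ≤ orderParameter U t T := by
    by_contra! hlt
    have := meanFieldIntegral_strictAnti t hT.1 hΔ hlt
    linarith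
  have hright : orderParameter U t T ≤ neelTemperature U t * (f + η) := by
    by_contra! hlt
    have := meanFieldIntegral_strictAnti t hT.1 (mul_pos hτ (by linarith : 0 < f + η)) hlt
    linarith
  have h5 := (le_div_iff₀ hτ).2 (by linarith : (f - η) * neelTemperature U t ≤ orderParameter U t T)
  have h6 := (div_le_iff₀ hτ).2 (by linarith : orderParameter U t T ≤ (f + η) * neelTemperature U t)
  rw [abs_le]
  constructor <;> linarith

/-- The estimate of the gap ratio in terms of the Néel temperature. Since the BCS gap decreases in
`y`, it is bounded below by its value at the largest `y` in `K₂`. -/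
theorem exists_abs_gapRatio_sub_le {K₁ : Set ℝ} (hK₁ : IsCompact K₁) (h₁ : K₁ ⊆ Ioo (0 : ℝ) 2)
    {K₂ : Set ℝ} (hK₂ : IsCompact K₂) (h₂ : K₂ ⊆ Ico (0 : ℝ) 1) :
    ∃ C : ℝ, 0 < C ∧ ∃ U₀ : ℝ, 0 < U₀ ∧ U₀ < 1 ∧ ∀ U ∈ Ioo 0 U₀, ∀ t ∈ K₁, ∀ T : ℝ, 0 ≤ T →
      T / neelTemperature U t ∈ K₂ →
        |gapRatio U t T - fBCS (T / neelTemperature U t)| ≤ C * (neelTemperature U t ^ 2 / U) := by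
  rcases K₂.eq_empty_or_nonempty with rfl | hne
  · exact ⟨1, one_pos, 1 / 2, by norm_num, by norm_num, fun U _ t _ T _ hT => absurd hT (by simp)⟩
  obtain ⟨y₀, hy₀, hmax⟩ := hK₂.exists_isMaxOn hne continuousOn_id
  have hx₀ := fBCS_pos (h₂ hy₀)
  set x₀ := fBCS y₀ with hx₀def
  obtain ⟨c, hc, H₁⟩ := exists_bcsIntegral_sub_ge 3
  obtain ⟨C, hC, H₂⟩ := exists_abs_meanFieldIntegral_sub_le hK₁ h₁ (half_pos hx₀) 3
  have hV := two_pi_pow_three_pos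
  set V := (2 * Real.pi) ^ 3 with hVdef
  -- chosen such that changing the gap by `D τ² / U` outweighs the error term
  set D := 16 * (C * (1 + 2 * V)) / (c * x₀) with hD
  have hD0 : 0 < D := by positivity
  set m := min (x₀ / 2) 1 with hm
  have hm0 : 0 < m := by positivity
  refine ⟨D, hD0, min (1 / 2) (m / D), by positivity,
    (min_le_left _ _).trans_lt (by norm_num), ?_⟩
  intro U hU t ht T hT hy
  have hU0 := hU.1
  have hU1 : U < 1 := hU.2.trans_le ((min_le_left _ _).trans (by norm_num))
  have hUD : U * D < m := (lt_div_iff₀ hD0).1 (hU.2.trans_le (min_le_right _ _))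
  have ht2 := h₁ ht
  obtain ⟨hτ, hτU⟩ := neelTemperature_spec ht2 hU0
  have hτ4 := neelTemperature_le ht2 hU0
  have hyI := h₂ hy
  have hyy₀ : T / neelTemperature U t ≤ y₀ := hmax hy
  have hf2 := fBCS_le_two hyI
  have hf0 : x₀ ≤ fBCS (T / neelTemperature U t) := fBCS_antitone hyI.1 hyy₀ (h₂ hy₀).2
  have hTT : T ∈ Ico 0 (neelTemperature U t) := ⟨hT, by
    have := hyI.2
    rwa [div_lt_one hτ] at this⟩
  have hNV : 1 / 32 ≤ V * fermiDensity t := by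
    have := le_fermiDensity ht2
    rw [div_le_iff₀ (by positivity)] at this
    linarith
  have hN := fermiDensity_pos ht2
  set τ := neelTemperature U t with hτdef
  set y := T / τ with hydef
  set f := fBCS y with hf
  have hyIcc : y ∈ Icc (0 : ℝ) 1 := ⟨hyI.1, hyI.2.le⟩
  have hτy : τ * y = T := by rw [hydef]; field_simp
  have hfJ : bcsIntegral f y = 0 := bcsIntegral_fBCS hyIcc
  set η := D * (τ ^ 2 / U) with hη
  have hη0 : 0 < η := by positivity
  have hηm : η ≤ m := by
    have h1 : τ ^ 2 / U ≤ U := by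
      rw [div_le_iff₀ hU0]
      nlinarith
    calc η ≤ D * U := by rw [hη]; gcongr
      _ ≤ m := by linarith
  have hη1 : η ≤ x₀ / 2 := hηm.trans (min_le_left _ _)
  have hη2 : η ≤ 1 := hηm.trans (min_le_right _ _)
  -- the error term is dominated by the change of `J` when the gap changes by `η`
  have herr : ∀ x ∈ Icc (x₀ / 2) 3,
      |meanFieldIntegral t T (τ * x) - 2 * V / U - V * (2 * fermiDensity t * bcsIntegral x y)| ≤
        V * (2 * fermiDensity t * (c * (x₀ * η))) := by
    intro x hx
    have h := H₂ t ht τ hτ x hx y hyIcc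
    rw [hτy, hτU] at h
    refine h.trans ?_
    have h1 : 1 + 2 * V / U ≤ (1 + 2 * V) / U := by
      rw [add_div]
      gcongr
      rw [le_div_iff₀ hU0]
      linarith
    have e1 : c * (x₀ * η) = 16 * (C * (1 + 2 * V)) * (τ ^ 2 / U) := by
      rw [hη, hD]; field_simp
    calc C * τ ^ 2 * (1 + 2 * V / U) ≤ C * τ ^ 2 * ((1 + 2 * V) / U) := by gcongr
      _ = 2 * (1 / 32) * (16 * (C * (1 + 2 * V)) * (τ ^ 2 / U)) := by ring
      _ ≤ 2 * (V * fermiDensity t) * (16 * (C * (1 + 2 * V)) * (τ ^ 2 / U)) := by gcongr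
      _ = _ := by rw [e1]; ring
  have hpos : ∀ x, 0 < x → IntegrableOn (bcsKernel x y) (Ioi 0) := fun x hx =>
    integrableOn_bcsKernel hx.le hyIcc (Or.inl hx)
  have hlow : 2 * V / U ≤ meanFieldIntegral t T (τ * (f - η)) := by
    have h1 := (abs_le.1 (herr (f - η) ⟨by linarith, by linarith⟩)).1
    have h2 := H₁ y hyIcc (f - η) f (by linarith) (by linarith) (by linarith)
      (hpos _ (by linarith)) (hpos _ (by linarith))
    rw [hfJ, sub_zero] at h2
    have h3 : c * (x₀ * η) ≤ bcsIntegral (f - η) y := by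
      refine le_trans ?_ h2
      gcongr
      nlinarith
    have h4 : V * (2 * fermiDensity t * (c * (x₀ * η))) ≤
        V * (2 * fermiDensity t * bcsIntegral (f - η) y) := by gcongr
    linarith
  have hup : meanFieldIntegral t T (τ * (f + η)) ≤ 2 * V / U := by
    have h1 := (abs_le.1 (herr (f + η) ⟨by linarith, by linarith⟩)).2
    have h2 := H₁ y hyIcc f (f + η) (by linarith) (by linarith) (by linarith)
      (hpos _ (by linarith)) (hpos _ (by linarith))
    rw [hfJ, zero_sub] at h2
    have h3 : c * (x₀ * η) ≤ -bcsIntegral (f + η) y := by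
      refine le_trans ?_ h2
      gcongr
      nlinarith
    have h4 : V * (2 * fermiDensity t * (c * (x₀ * η))) ≤
        V * (2 * fermiDensity t * -bcsIntegral (f + η) y) := by gcongr
    linarith
  exact abs_gapRatio_sub_le_of_bracket ht2 hU0 hTT (by linarith) hη0.le hlow hup

end Hubbard3D

theorem theorem2p5 :
    -- the objects in the statement are well defined
    (∀ tz ∈ Set.Ioo (0 : ℝ) 2, 0 < Hubbard3D.densityOfStates tz 0) ∧
    (∀ tz ∈ Set.Ioo (0 : ℝ) 2, ∀ U : ℝ, 0 < U →
      ∃! T : ℝ, Hubbard3D.IsNeelTemperature U tz T) ∧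
    (∀ tz ∈ Set.Ioo (0 : ℝ) 2, ∀ U : ℝ, 0 < U →
      ∀ T ∈ Set.Ico (0 : ℝ) (Hubbard3D.neelTemperature U tz),
        ∃! Δ : ℝ, 0 < Δ ∧ Hubbard3D.IsMeanFieldSolution U tz T Δ) ∧
    (∀ y ∈ Set.Icc (0 : ℝ) 1, ∃! x : ℝ, Hubbard3D.IsBCSGap x y) ∧
    -- the uniform asymptotics of the gap ratio
    (∀ K₁ : Set ℝ, IsCompact K₁ → K₁ ⊆ Set.Ioo (0 : ℝ) 2 →
      ∀ K₂ : Set ℝ, IsCompact K₂ → K₂ ⊆ Set.Ico (0 : ℝ) 1 →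
        ∃ C : ℝ, 0 < C ∧ ∃ U₀ : ℝ, 0 < U₀ ∧
          ∀ U ∈ Set.Ioo (0 : ℝ) U₀, ∀ tz ∈ K₁, ∀ T : ℝ, 0 ≤ T →
            T / Hubbard3D.neelTemperature U tz ∈ K₂ →
              |Hubbard3D.gapRatio U tz T
                  - Hubbard3D.fBCS (T / Hubbard3D.neelTemperature U tz)|
                ≤ C * (U⁻¹ * Real.exp (-(2 / (Hubbard3D.densityOfStates tz 0 * U))))) := by
  refine ⟨fun tz htz => ?_, fun tz htz U hU => Hubbard3D.existsUnique_isNeelTemperature htz hU,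
    fun tz htz U hU T hT => Hubbard3D.existsUnique_isMeanFieldSolution htz hU hT,
    fun y hy => Hubbard3D.existsUnique_isBCSGap hy, fun K₁ hK₁ h₁ K₂ hK₂ h₂ => ?_⟩
  · rw [Hubbard3D.densityOfStates_zero htz]
    exact Hubbard3D.fermiDensity_pos htz
  obtain ⟨C, hC, U₀, hU₀, hU₀1, H⟩ := Hubbard3D.exists_abs_gapRatio_sub_le hK₁ h₁ hK₂ h₂
  obtain ⟨C', hC', H'⟩ := Hubbard3D.exists_neelTemperature_le_exp hK₁ h₁
  refine ⟨C * C' ^ 2, by positivity, U₀, hU₀, fun U hU tz htz T hT hy => ?_⟩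
  have hU0 := hU.1
  have h3 := H' tz htz U ⟨hU0, hU.2.trans hU₀1⟩
  have hτ := (Hubbard3D.neelTemperature_spec (h₁ htz) hU0).1
  refine (H U hU tz htz T hT hy).trans ?_
  rw [Hubbard3D.densityOfStates_zero (h₁ htz)]
  calc C * (Hubbard3D.neelTemperature U tz ^ 2 / U)
      ≤ C * ((C' * Real.exp (-(1 / (Hubbard3D.fermiDensity tz * U)))) ^ 2 / U) := by gcongr
    _ = _ := by
        rw [mul_pow, ← Real.exp_nat_mul]
        have : ((2 : ℕ) : ℝ) * -(1 / (Hubbard3D.fermiDensity tz * U)) =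
            -(2 / (Hubbard3D.fermiDensity tz * U)) := by push_cast; ring
        rw [this]
        ring
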